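/- Let $\mathcal{B}$ be Bring's curve over $\mathbb{C}$ in its Hulek--Craig model, i.e. the smooth projective curve (compact Riemann surface) obtained by desingularising the plane sextic $$F(X,Y,Z)=X(Y^5+Z^5)+(XYZ)^2-X^4YZ-2(YZ)^3=0,$$ and put $x=X/Z$, $y=Y/Z$, $f(x,y)=F(x,y,1)$. Let $a,b,c,d\in\mathcal{B}$ be the points determined by the local expansions, to leading order in a local parameter $t$, $$a\simeq[2t^3:t:1],\qquad b\simeq[2t^2:1/t:1],\qquad c\simeq[1:t:t^4],\qquad d\simeq[1:t^4:t]$$ of $[X:Y:Z]$ (each of these points exists and is unique), and put $$\Delta=3a+b-c,\qquad L=2d+b,\qquad L'=2b+c .$$ Let $$v_1=\frac{(y^3-x)\,dx}{\partial_yf},\quad v_2=\frac{(y^2x-1)\,dx}{\partial_yf},\quad v_3=\frac{(y-x^2)\,dx}{\partial_yf},\quad v_4=\frac{y(x^2-y)\,dx}{\partial_yf},$$ so that $[v_1:v_2:v_3:v_4]$ embeds $\mathcal{B}$ in the quadric $\mathcal{Q}:\ v_1v_2+v_3v_4=0$ of $\mathbb{P}^3$. Let $\varphi:\mathbb{P}^1\times\mathbb{P}^1\to\mathcal{Q}$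 be the isomorphism $\varphi([u:v],[z:w])=[uz:vw:vz:-uw]$, and let $f_1,f_2:\mathcal{B}\to\mathbb{P}^1$ be the restrictions to $\mathcal{B}$ of the two components of $\varphi^{-1}$. Then, counted with multiplicity, $L'=f_1^{-1}([1:0])$ and $L=f_2^{-1}([1:0])$. Moreover, writing $\sim$ for linear equivalence of divisors and $\mathcal{K}_{\mathcal{B}}$ for an arbitrary canonical divisor (the divisor of a nonzero meromorphic differential, which exists), one has $$\Delta\sim 3(L'-L)+L,\qquad \mathcal{K}_{\mathcal{B}}\sim L+L',\qquad 5(L'-L)\sim 0 .$$ -/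

import Mathlib

open Polynomial

namespace BringCurve

/-- The affine Hulek--Craig polynomial `f(x, y) = F(x, y, 1)`, where
`F(X, Y, Z) = X (Y⁵ + Z⁵) + (X Y Z)² - X⁴ Y Z - 2 (Y Z)³`. The outer polynomial variable `X`
is `x` and the inner variable `C X` is `y`. -/
noncomputable def hcPoly : ℂ[X][X] :=
  X * (C X ^ 5 + 1) + (X * C X) ^ 2 - X ^ 4 * C X - 2 * C X ^ 3

theorem hcPoly_no_root (r : ℂ[X]) :
    r * (X ^ 5 + 1) + r ^ 2 * X ^ 2 - r ^ 4 * X - 2 * X ^ 3 ≠ 0 := by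
  intro h
  have hd : r ∣ X ^ 3 := by
    refine (IsUnit.dvd_mul_left (u := (C (2:ℂ) : ℂ[X])) ?_).1 ⟨(X ^ 5 + 1) + r * X ^ 2 - r ^ 3 * X, ?_⟩
    · exact isUnit_C.2 (by norm_num)
    · simp only [map_ofNat]; linear_combination -h
  obtain ⟨j, hj, u, hu⟩ := (dvd_prime_pow prime_X 3).1 hd
  obtain ⟨c, hc, hcu⟩ := Polynomial.isUnit_iff.1 (u⁻¹).isUnit
  have hr : r = C c * X ^ j := by
    rw [hcu, ← hu, mul_comm, mul_assoc, Units.mul_inv, mul_one]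
  have hc0 : c ≠ 0 := hc.ne_zero
  subst hr
  have h1 : C (c ^ 4) * X ^ (4 * j + 1) = C c * X ^ (j + 5) + C c * X ^ j
      + C (c ^ 2) * X ^ (2 * j + 2) - C 2 * X ^ 3 := by
    simp only [map_pow, map_ofNat]
    linear_combination -h
  have h2 := congrArg (fun p : ℂ[X] => p.coeff (4 * j + 1)) h1
  have h3 := congrArg (fun p : ℂ[X] => p.coeff 5) h1
  simp only [coeff_add, coeff_sub, coeff_C_mul, coeff_X_pow] at h2 h3
  interval_cases j <;> simp [hc0] at h2 h3

theorem hcPoly_coeff : hcPoly.coeff 0 = -2 * X ^ 3 ∧ hcPoly.coeff 1 = X ^ 5 + 1 ∧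
    hcPoly.coeff 2 = X ^ 2 ∧ hcPoly.coeff 3 = 0 ∧ hcPoly.coeff 4 = -X := by
  have h : hcPoly = C (-2 * X ^ 3) + C (X ^ 5 + 1) * X ^ 1 + C (X ^ 2) * X ^ 2 + C (-X) * X ^ 4 := by
    simp only [hcPoly, map_add, map_mul, map_neg, map_pow, map_one, map_ofNat]; ring
  rw [h]
  simp only [coeff_add, coeff_C_mul, coeff_X_pow, coeff_C]
  simp

theorem hcPoly_natDegree : hcPoly.natDegree = 4 := by
  have h : hcPoly = C (-X) * X ^ 4 + C (X ^ 2) * X ^ 2 + C (X ^ 5 + 1) * X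
      + C (-2 * X ^ 3) := by
    simp only [hcPoly, map_add, map_mul, map_neg, map_pow, map_one, map_ofNat]; ring
  rw [h]
  compute_degree!

theorem X_mul_ne_one (p : ℂ[X]) : X * p ≠ 1 := by
  intro h
  have := congrArg (eval 0) h
  simp at this

theorem no_quadratic_factor {a0 a1 a2 b0 b1 b2 : ℂ[X]} (ha : IsUnit a2)
    (c1 : a0 * b1 + a1 * b0 = X ^ 5 + 1)
    (c2 : a0 * b2 + a1 * b1 + a2 * b0 = X ^ 2) (c3 : a1 * b2 + a2 * b1 = 0)
    (c4 : a2 * b2 = -X) : False := by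
  obtain ⟨w, hw⟩ := ha.exists_right_inv
  have hb2 : b2 = X * -w := by linear_combination w * c4 - b2 * hw
  have hb1 : b1 = X * (a1 * w ^ 2) := by
    linear_combination w * c3 - b1 * hw - w * a1 * hb2
  have hb0 : b0 = X * (w * X + w ^ 2 * a0 - w * a1 ^ 2 * w ^ 2) := by
    linear_combination w * c2 - b0 * hw - w * a0 * hb2 - w * a1 * hb1
  refine X_mul_ne_one (a0 * (a1 * w ^ 2) +
    a1 * (w * X + w ^ 2 * a0 - w * a1 ^ 2 * w ^ 2) - X ^ 4) ?_
  linear_combination c1 - a0 * hb1 - a1 * hb0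

theorem hcPoly_factor_aux {G H : ℂ[X][X]} (hGH : hcPoly = G * H)
    (hle : G.natDegree ≤ H.natDegree) : IsUnit G := by
  obtain ⟨c0, c1, c2, c3, c4⟩ := hcPoly_coeff
  have hF0 : hcPoly ≠ 0 := by
    intro h; have := hcPoly_natDegree; rw [h] at this; simp at this
  have hG0 : G ≠ 0 := by rintro rfl; simp at hGH; exact hF0 hGH
  have hH0 : H ≠ 0 := by rintro rfl; simp at hGH; exact hF0 hGH
  have hdeg : G.natDegree + H.natDegree = 4 := by
    rw [← natDegree_mul hG0 hH0, ← hGH, hcPoly_natDegree]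
  have hX : Irreducible (X : ℂ[X]) := irreducible_X
  have hg : G.natDegree ≤ 2 := by omega
  generalize hgd : G.natDegree = g at *
  rw [hGH] at c0 c1 c2 c3 c4
  simp only [coeff_mul, Finset.Nat.sum_antidiagonal_eq_sum_range_succ_mk,
    Finset.sum_range_succ, Finset.sum_range_zero] at c0 c1 c2 c3 c4
  simp only [zero_add, Nat.sub_zero, Nat.sub_self, Nat.reduceSub] at c0 c1 c2 c3 c4
  have gz : ∀ n, g < n → G.coeff n = 0 := fun n hn =>
    coeff_eq_zero_of_natDegree_lt (by omega)
  have hz : ∀ n, 4 - g < n → H.coeff n = 0 := fun n hn =>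
    coeff_eq_zero_of_natDegree_lt (by omega)
  interval_cases g
  · rw [gz 1 (by norm_num)] at c1 c2 c3 c4
    rw [gz 2 (by norm_num)] at c2 c3 c4
    rw [gz 3 (by norm_num)] at c3 c4
    rw [gz 4 (by norm_num)] at c4
    rw [eq_C_of_natDegree_eq_zero hgd, isUnit_C]
    refine isUnit_of_dvd_one ⟨H.coeff 1 + X ^ 4 * H.coeff 4, ?_⟩
    linear_combination -c1 - X ^ 4 * c4
  · exfalso
    rw [gz 2 (by norm_num)] at c2 c3 c4
    rw [gz 3 (by norm_num)] at c3 c4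
    rw [gz 4 (by norm_num)] at c4
    rw [hz 4 (by norm_num)] at c4
    have hu := hX.isUnit_or_isUnit (a := -G.coeff 1) (b := H.coeff 3) (by linear_combination c4)
    rcases hu with hu | hu
    · obtain ⟨w, hw⟩ := hu.exists_right_inv
      refine hcPoly_no_root (G.coeff 0 * w) ?_
      set r := G.coeff 0 * w with hr
      linear_combination -c0 - r * c1 - r ^ 2 * c2 - r ^ 3 * c3 - r ^ 4 * c4 +
        (-G.coeff 0 * hw + G.coeff 1 * hr) *
          (H.coeff 0 + r * H.coeff 1 + r ^ 2 * H.coeff 2 + r ^ 3 * H.coeff 3)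
    · obtain ⟨w, hw⟩ := hu.exists_right_inv
      have h1 : G.coeff 1 = -X * w := by linear_combination w * c4 - G.coeff 1 * hw
      have h0 : G.coeff 0 = X * w ^ 2 * H.coeff 2 := by
        linear_combination w * c3 - G.coeff 0 * hw - w * H.coeff 2 * h1
      refine X_mul_ne_one (w ^ 2 * H.coeff 2 * H.coeff 1 - w * H.coeff 0 - X ^ 4) ?_
      linear_combination c1 - H.coeff 1 * h0 - H.coeff 0 * h1
  · exfalso
    rw [gz 3 (by norm_num)] at c3 c4
    rw [gz 4 (by norm_num)] at c4
    rw [hz 3 (by norm_num)] at c3 c4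
    rw [hz 4 (by norm_num)] at c4
    have hu := hX.isUnit_or_isUnit (a := -G.coeff 2) (b := H.coeff 2) (by linear_combination c4)
    rcases hu with hu | hu
    · exact no_quadratic_factor (a0 := G.coeff 0) (a1 := G.coeff 1) (a2 := G.coeff 2)
        (b0 := H.coeff 0) (b1 := H.coeff 1) (b2 := H.coeff 2) (by simpa using hu) c1
        (by linear_combination c2) (by linear_combination c3) (by linear_combination c4)
    · exact no_quadratic_factor (a0 := H.coeff 0) (a1 := H.coeff 1) (a2 := H.coeff 2)
        (b0 := G.coeff 0) (b1 := G.coeff 1) (b2 := G.coeff 2) hu (by linear_combination c1)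
        (by linear_combination c2) (by linear_combination c3) (by linear_combination c4)

theorem hcPoly_irreducible : Irreducible hcPoly := by
  refine ⟨fun h => ?_, fun G H hGH => ?_⟩
  · have := natDegree_eq_zero_of_isUnit h
    rw [hcPoly_natDegree] at this
    omega
  · rcases le_total G.natDegree H.natDegree with h | h
    · exact Or.inl (hcPoly_factor_aux hGH h)
    · exact Or.inr (hcPoly_factor_aux (by rw [hGH, mul_comm]) h)

instance : IsDomain (AdjoinRoot hcPoly) :=
  AdjoinRoot.isDomain_of_prime hcPoly_irreducible.prime

/-- The field of meromorphic functions on Bring's curve: the function field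
`ℂ(x, y)` with `f(x, y) = 0` of its Hulek--Craig model. -/
abbrev FunctionField : Type := FractionRing (AdjoinRoot hcPoly)

/-- The coordinate function `x = X / Z`. -/
noncomputable def x : FunctionField :=
  algebraMap (AdjoinRoot hcPoly) FunctionField (AdjoinRoot.root hcPoly)

/-- The coordinate function `y = Y / Z`. -/
noncomputable def y : FunctionField :=
  algebraMap (AdjoinRoot hcPoly) FunctionField (AdjoinRoot.of hcPoly X)

/-- The points of Bring's curve, i.e. of the compact Riemann surface (smooth projective curve)
obtained by desingularising the Hulek--Craig model, given as the places of its function field: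
the normalised discrete valuations that are trivial on `ℂ`. -/
structure Point where
  /-- the multiplicative valuation `g ↦ exp (- ord g)` -/
  val : Valuation FunctionField (WithZero (Multiplicative ℤ))
  surjective : Function.Surjective val
  trivial_on_const : ∀ z : ℂ, z ≠ 0 → val (algebraMap ℂ FunctionField z) = 1

/-- The order of vanishing of a nonzero function at a point (the value at `0` is `0` by
convention). -/
noncomputable def Point.ord (P : Point) (g : FunctionField) : ℤ :=
  -WithZero.log (P.val g)

/-- `g = z t ^ n + (terms of higher order)` at `P`, where `t` is a local parameter at `P`
and `z ≠ 0`. -/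
def Point.HasLeadingTerm (P : Point) (t g : FunctionField) (z : ℂ) (n : ℤ) : Prop :=
  P.val (g / (algebraMap ℂ FunctionField z * t ^ n) - 1) < 1

/-- `P` is the point of the curve with local expansion `[X : Y : Z] ≃ [2 t³ : t : 1]`. -/
def IsPointA (P : Point) : Prop :=
  ∃ t, P.ord t = 1 ∧ P.HasLeadingTerm t x 2 3 ∧ P.HasLeadingTerm t y 1 1

/-- `P` is the point of the curve with local expansion `[X : Y : Z] ≃ [2 t² : 1 / t : 1]`. -/
def IsPointB (P : Point) : Prop :=
  ∃ t, P.ord t = 1 ∧ P.HasLeadingTerm t x 2 2 ∧ P.HasLeadingTerm t y 1 (-1)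

/-- `P` is the point of the curve with local expansion `[X : Y : Z] ≃ [1 : t : t⁴]`, so that
`x = X / Z = t⁻⁴ + ⋯` and `y = Y / Z = t⁻³ + ⋯`. -/
def IsPointC (P : Point) : Prop :=
  ∃ t, P.ord t = 1 ∧ P.HasLeadingTerm t x 1 (-4) ∧ P.HasLeadingTerm t y 1 (-3)

/-- `P` is the point of the curve with local expansion `[X : Y : Z] ≃ [1 : t⁴ : t]`, so that
`x = X / Z = t⁻¹ + ⋯` and `y = Y / Z = t³ + ⋯`. -/
def IsPointD (P : Point) : Prop :=
  ∃ t, P.ord t = 1 ∧ P.HasLeadingTerm t x 1 (-1) ∧ P.HasLeadingTerm t y 1 3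

/-- Divisors on Bring's curve. -/
abbrev Divisor : Type := Point →₀ ℤ

/-- The prime divisor of a point. -/
noncomputable def pt (P : Point) : Divisor := Finsupp.single P 1

/-- Linear equivalence: `D - E` is the divisor of a nonzero meromorphic function. -/
def LinEquiv (D E : Divisor) : Prop :=
  ∃ g : FunctionField, g ≠ 0 ∧ ∀ P : Point, (D - E) P = P.ord g

/-- `E` is the divisor of the meromorphic differential `ω`: at each point `P` one has
`ω = g dt` with `t` a local parameter at `P` and `ord_P g = E P`. -/
def IsDivisorOfDifferential (ω : Ω[FunctionField⁄ℂ]) (E : Divisor) : Prop :=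
  ∀ P : Point, ∃ t g : FunctionField, P.ord t = 1 ∧ g ≠ 0 ∧
    ω = g • KaehlerDifferential.D ℂ FunctionField t ∧ P.ord g = E P

/-- Canonical divisors: the divisors of nonzero meromorphic differentials. -/
def IsCanonical (E : Divisor) : Prop :=
  ∃ ω : Ω[FunctionField⁄ℂ], ω ≠ 0 ∧ IsDivisorOfDifferential ω E

/-- The function `∂f/∂y = 5 x y⁴ + 2 x² y - x⁴ - 6 y²`. -/
noncomputable def fy : FunctionField := 5 * x * y ^ 4 + 2 * x ^ 2 * y - x ^ 4 - 6 * y ^ 2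

/-- The numerators of the differentials `v₁, …, v₄` over `dx / (∂f/∂y)`. -/
noncomputable def vNum : Fin 4 → FunctionField :=
  ![y ^ 3 - x, y ^ 2 * x - 1, y - x ^ 2, y * (x ^ 2 - y)]

/-- The basis `v₁, …, v₄` of holomorphic differentials; the canonical embedding of Bring's curve
is `[v₁ : v₂ : v₃ : v₄]`, and its image lies on the quadric `v₁ v₂ + v₃ v₄ = 0`. -/
noncomputable def v (i : Fin 4) : Ω[FunctionField⁄ℂ] :=
  (vNum i / fy) • KaehlerDifferential.D ℂ FunctionField x

/-- The isomorphism `φ([u : v], [z : w]) = [u z : v w : v z : - u w]` from `ℙ¹ × ℙ¹` onto the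
quadric `v₁ v₂ + v₃ v₄ = 0`, in homogeneous coordinates. -/
def phi {K : Type*} [Field K] (s r : Fin 2 → K) : Fin 4 → K :=
  ![s 0 * r 0, s 1 * r 1, s 1 * r 0, -(s 0 * r 1)]

/-- `f₁ = [s 0 : s 1]` and `f₂ = [r 0 : r 1]` are the two components `π₁ ∘ φ⁻¹` and `π₂ ∘ φ⁻¹` of
`φ⁻¹` restricted to the canonically embedded curve: `φ(f₁, f₂) = [v₁ : v₂ : v₃ : v₄]`. -/
def AreRulings (s r : Fin 2 → FunctionField) : Prop :=
  ∃ η : Ω[FunctionField⁄ℂ], η ≠ 0 ∧ ∀ i, v i = phi s r i • η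

/-- `D` is the fibre, with multiplicities, over `[1 : 0]` of the map `[s 0 : s 1]` from Bring's
curve to `ℙ¹`; the function `s 1 / s 0` is the pullback of the local coordinate at `[1 : 0]`. -/
def IsFibreOneZero (s : Fin 2 → FunctionField) (D : Divisor) : Prop :=
  s 0 ≠ 0 ∧ s 1 ≠ 0 ∧ ∀ P : Point, D P = max (P.ord (s 1 / s 0)) 0

end BringCurve

namespace BringCurve

/-! The ruling functions `U = v₃ / v₁` and `W = v₂ / v₃ = y U` generate the function field and
satisfy `U (1 - U² W) = W² (1 + U² W)`, the equation of a curve of bidegree `(3, 3)` on `ℙ¹ × ℙ¹`.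
With `s = U² W` this becomes the Kummer equation `U⁵ (1 - s) = s² (1 + s)`. Hence `s` presents the
curve as a cyclic cover of degree five of the line, totally ramified exactly over `s = ∞, 0, -1, 1`.
The points above these values are `a, b, c, d`.

Everything then follows from four divisors: `div U = 2b + c - 2a - d`, `div W = b + 2d - a - 2c`,
`div (1 + s) = 5c - 5a`, `div (1 - s) = 5d - 5a`. The zeros of `U` and `W` are `L'` and `L`. The
differential `ds` has divisor `4b + 4c + 4d - 6a`, and each linear equivalence is witnessed by a
monomial in `U, W, 1 + s, 1 - s`, times an arbitrary factor in the canonical case.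

Points are valuations, so three general facts are needed. At a smooth point of a plane chart every
function is a power of the parameter times a unit, which fixes the valuation (`IsChart.val_unique`)
and the order of differentials (`IsChart.exists_D_eq`). A transcendental function has a zero
(`exists_isPlace_val_lt_one`), which gives existence of the four points. A function without pole
takes a value in `ℂ` (`IsPlace.exists_const`), which handles the unramified points. `hasOrds_cases`
combines these into the full list of possible orders. -/

theorem log_neg_of_val_lt_one {K : Type*} [Field K]
    {v : Valuation K (WithZero (Multiplicative ℤ))} {t : K} (ht0 : t ≠ 0) (ht : v t < 1) : WithZero.log (v t) < 0 := by
  rw [WithZero.log_lt_iff_lt_exp (by simpa using ht0)]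
  simpa using ht

/-! ### Valuations and differentials at a smooth point of a plane chart -/

section LocalTheory

variable {K : Type*} [Field K] [Algebra ℂ K]

/-- The valuation is normalised and trivial on the constants. -/
structure IsPlace (v : Valuation K (WithZero (Multiplicative ℤ))) : Prop where
  surjective : Function.Surjective v
  map_const : ∀ z : ℂ, z ≠ 0 → v (algebraMap ℂ K z) = 1

/-- The local algebraic equation of a smooth plane chart centred at the origin. -/
structure IsChart (t w : K) : Prop where
  top : IntermediateField.adjoin ℂ {t, w} = ⊤
  rel : ∃ q₀ : ℂ, q₀ ≠ 0 ∧ ∃ p ∈ Algebra.adjoin ℂ {t, w}, ∃ q₁ ∈ Algebra.adjoin ℂ {t, w},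
    ∃ q₂ ∈ Algebra.adjoin ℂ {t, w}, w * (algebraMap ℂ K q₀ + t * q₁ + w * q₂) = t * p

/-- The polynomial expressions in `t, w` with nonzero constant term. -/
def UnitAt (t w h : K) : Prop :=
  ∃ c : ℂ, c ≠ 0 ∧ ∃ h₁ ∈ Algebra.adjoin ℂ {t, w}, ∃ h₂ ∈ Algebra.adjoin ℂ {t, w},
    h = algebraMap ℂ K c + t * h₁ + w * h₂

variable {v v' : Valuation K (WithZero (Multiplicative ℤ))} {t w : K}

theorem mem_adjoin_left (t w : K) : t ∈ Algebra.adjoin ℂ {t, w} :=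
  Algebra.subset_adjoin (by simp)

theorem mem_adjoin_right (t w : K) : w ∈ Algebra.adjoin ℂ {t, w} :=
  Algebra.subset_adjoin (by simp)

theorem UnitAt.mem {h : K} (hh : UnitAt t w h) : h ∈ Algebra.adjoin ℂ {t, w} := by
  obtain ⟨c, -, h₁, m₁, h₂, m₂, rfl⟩ := hh
  exact add_mem (add_mem (Subalgebra.algebraMap_mem _ c) (mul_mem (mem_adjoin_left t w) m₁))
    (mul_mem (mem_adjoin_right t w) m₂)

theorem IsPlace.const_le (hv : IsPlace v) (z : ℂ) : v (algebraMap ℂ K z) ≤ 1 := by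
  by_cases hz : z = 0
  · simp [hz]
  · exact (hv.map_const z hz).le

theorem IsPlace.adjoin_le (hv : IsPlace v) (ht : v t ≤ 1) (hw : v w ≤ 1) {h : K}
    (hh : h ∈ Algebra.adjoin ℂ {t, w}) : v h ≤ 1 := by
  induction hh using Algebra.adjoin_induction with
  | mem x hx => rcases hx with rfl | rfl <;> assumption
  | algebraMap r => exact hv.const_le r
  | add x y _ _ hx hy => exact v.map_add_le hx hy
  | mul x y _ _ hx hy => rw [map_mul]; exact mul_le_one' hx hy

theorem adjoin_decomp {h : K} (hh : h ∈ Algebra.adjoin ℂ {t, w}) :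
    ∃ c : ℂ, ∃ h₁ ∈ Algebra.adjoin ℂ {t, w}, ∃ h₂ ∈ Algebra.adjoin ℂ {t, w},
      h = algebraMap ℂ K c + t * h₁ + w * h₂ := by
  induction hh using Algebra.adjoin_induction with
  | mem x hx =>
    rcases hx with rfl | rfl
    · exact ⟨0, 1, one_mem _, 0, zero_mem _, by simp⟩
    · exact ⟨0, 0, zero_mem _, 1, one_mem _, by simp⟩
  | algebraMap r => exact ⟨r, 0, zero_mem _, 0, zero_mem _, by simp⟩
  | add x y _ _ hx hy =>
    obtain ⟨c, a, ha, b, hb, rfl⟩ := hx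
    obtain ⟨c', a', ha', b', hb', rfl⟩ := hy
    exact ⟨c + c', a + a', add_mem ha ha', b + b', add_mem hb hb', by rw [map_add]; ring⟩
  | mul x y mx my hx hy =>
    obtain ⟨c, a, ha, b, hb, hx⟩ := hx
    obtain ⟨c', a', ha', b', hb', hy⟩ := hy
    refine ⟨c * c', algebraMap ℂ K c * a' + a * y,
      add_mem (mul_mem (Subalgebra.algebraMap_mem _ c) ha') (mul_mem ha my),
      algebraMap ℂ K c * b' + b * y,
      add_mem (mul_mem (Subalgebra.algebraMap_mem _ c) hb') (mul_mem hb my), ?_⟩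
    rw [map_mul, hx]
    linear_combination (algebraMap ℂ K c) * hy

theorem UnitAt.one : UnitAt t w 1 :=
  ⟨1, one_ne_zero, 0, zero_mem _, 0, zero_mem _, by simp⟩

theorem UnitAt.mul {h k : K} (hh : UnitAt t w h) (hk : UnitAt t w k) : UnitAt t w (h * k) := by
  have mk := hk.mem
  obtain ⟨c, c0, a, ha, b, hb, hx⟩ := hh
  obtain ⟨c', c0', a', ha', b', hb', hy⟩ := hk
  refine ⟨c * c', mul_ne_zero c0 c0', algebraMap ℂ K c * a' + a * k,
    add_mem (mul_mem (Subalgebra.algebraMap_mem _ c) ha') (mul_mem ha mk),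
    algebraMap ℂ K c * b' + b * k,
    add_mem (mul_mem (Subalgebra.algebraMap_mem _ c) hb') (mul_mem hb mk), ?_⟩
  rw [map_mul, hx]
  linear_combination (algebraMap ℂ K c) * hy

theorem UnitAt.pow {h : K} (hh : UnitAt t w h) (n : ℕ) : UnitAt t w (h ^ n) := by
  induction n with
  | zero => simpa using UnitAt.one
  | succ n ih => rw [pow_succ]; exact ih.mul hh

theorem IsPlace.val_unitAt (hv : IsPlace v) (ht : v t < 1) (hw : v w < 1) {h : K}
    (hh : UnitAt t w h) : v h = 1 := by
  obtain ⟨c, c0, a, ha, b, hb, rfl⟩ := hh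
  have h1 : v (t * a) < 1 := by
    rw [map_mul]; exact mul_lt_one_of_lt_of_le ht (hv.adjoin_le ht.le hw.le ha)
  have h2 : v (w * b) < 1 := by
    rw [map_mul]; exact mul_lt_one_of_lt_of_le hw (hv.adjoin_le ht.le hw.le hb)
  rw [add_assoc, v.map_add_eq_of_lt_left, hv.map_const c c0]
  rw [hv.map_const c c0]
  exact v.map_add_lt h1 h2

/-- Every nonzero polynomial expression is a unit times a power of `t` in the local ring. -/
theorem IsChart.exists_pow_mul_unit_of_mem (hc : IsChart t w) (hv : IsPlace v) (ht0 : t ≠ 0)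
    (ht : v t < 1) (hw : v w < 1) {h : K} (hh : h ∈ Algebra.adjoin ℂ {t, w}) (h0 : h ≠ 0) :
    ∃ n : ℕ, ∃ e₁ e₂ : K, UnitAt t w e₁ ∧ UnitAt t w e₂ ∧ h * e₁ = t ^ n * e₂ := by
  obtain ⟨q₀, hq₀, p, hp, q₁, hq₁, q₂, hq₂, rel⟩ := hc.rel
  set q := algebraMap ℂ K q₀ + t * q₁ + w * q₂ with hq
  have uq : UnitAt t w q := ⟨q₀, hq₀, q₁, hq₁, q₂, hq₂, rfl⟩
  -- Induction on a bound for the order of `h`: each extracted factor `t` lowers the order by at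
  -- least one, so the process stops.
  obtain ⟨m, hm⟩ : ∃ m : ℕ, -WithZero.log (v h) ≤ m := ⟨_, Int.self_le_toNat _⟩
  induction m generalizing h with
  | zero =>
    obtain ⟨c, h₁, m₁, h₂, m₂, e⟩ := adjoin_decomp hh
    by_cases c0 : c = 0
    · exfalso
      have : v h < 1 := by
        rw [e, c0, map_zero, zero_add]
        refine v.map_add_lt ?_ ?_ <;> rw [map_mul]
        · exact mul_lt_one_of_lt_of_le ht (hv.adjoin_le ht.le hw.le m₁)
        · exact mul_lt_one_of_lt_of_le hw (hv.adjoin_le ht.le hw.le m₂)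
      have := log_neg_of_val_lt_one h0 this
      simp at hm
      omega
    · exact ⟨0, 1, h, UnitAt.one, ⟨c, c0, h₁, m₁, h₂, m₂, e⟩, by simp⟩
  | succ m ih =>
    obtain ⟨c, h₁, m₁, h₂, m₂, e⟩ := adjoin_decomp hh
    by_cases c0 : c = 0
    -- Without constant term, multiplication by the unit `q` turns the `w`-part into a multiple of
    -- `t`, because `w q = t p`.
    · have e' : h * q = t * (h₁ * q + h₂ * p) := by
        rw [c0, map_zero, zero_add] at e
        linear_combination q * e + h₂ * rel
      have hmem : h₁ * q + h₂ * p ∈ Algebra.adjoin ℂ {t, w} :=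
        add_mem (mul_mem m₁ uq.mem) (mul_mem m₂ hp)
      have vq := hv.val_unitAt ht hw uq
      have q0 : q ≠ 0 := by intro h; rw [h] at vq; simp at vq
      have k0 : h₁ * q + h₂ * p ≠ 0 := by
        intro hz; rw [hz, mul_zero] at e'; exact mul_ne_zero h0 q0 e'
      have hl := congrArg (fun g => WithZero.log (v g)) e'
      simp only [map_mul, vq, mul_one] at hl
      rw [WithZero.log_mul (by simpa using ht0) (by simpa using k0)] at hl
      have := log_neg_of_val_lt_one ht0 ht
      obtain ⟨n, e₁, e₂, u₁, u₂, he⟩ := ih hmem k0 (by push_cast at hm; omega)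
      exact ⟨n + 1, q * e₁, e₂, uq.mul u₁, u₂, by rw [pow_succ]; linear_combination e₁ * e' + t * he⟩
    · exact ⟨0, 1, h, UnitAt.one, ⟨c, c0, h₁, m₁, h₂, m₂, e⟩, by simp⟩

theorem IsChart.exists_zpow_mul_unit (hc : IsChart t w) (hv : IsPlace v) (ht0 : t ≠ 0)
    (ht : v t < 1) (hw : v w < 1) {h : K} (h0 : h ≠ 0) :
    ∃ n : ℤ, ∃ e₁ e₂ : K, UnitAt t w e₁ ∧ UnitAt t w e₂ ∧ h = t ^ n * (e₁ / e₂) := by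
  have hmem : h ∈ IntermediateField.adjoin ℂ {t, w} := by rw [hc.top]; trivial
  obtain ⟨r, hr, s, hs, rfl⟩ := IntermediateField.mem_adjoin_iff_div.1 hmem
  have r0 : r ≠ 0 := by rintro rfl; simp at h0
  have s0 : s ≠ 0 := by rintro rfl; simp at h0
  obtain ⟨n, a₁, a₂, u₁, u₂, ha⟩ := hc.exists_pow_mul_unit_of_mem hv ht0 ht hw hr r0
  obtain ⟨m, b₁, b₂, w₁, w₂, hb⟩ := hc.exists_pow_mul_unit_of_mem hv ht0 ht hw hs s0
  have nz : ∀ {e}, UnitAt t w e → e ≠ 0 := by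
    intro e he h; have := hv.val_unitAt ht hw he; rw [h] at this; simp at this
  refine ⟨n - m, a₂ * b₁, a₁ * b₂, u₂.mul w₁, u₁.mul w₂, ?_⟩
  have := nz u₁; have := nz u₂; have := nz w₁; have := nz w₂
  rw [zpow_sub₀ ht0, zpow_natCast, zpow_natCast]
  field_simp
  linear_combination (b₂ * t ^ m) * ha - (t ^ n * a₂) * hb

theorem IsPlace.exists_val_eq (hv : IsPlace v) : ∃ h : K, v h = WithZero.exp (-1 : ℤ) :=
  hv.surjective _

/-- Units have valuation one, so the value of `t` generates the value group. Since `v` is onto, the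
order of `t` divides one, and it is positive. -/
theorem IsChart.val_param (hc : IsChart t w) (hv : IsPlace v) (ht0 : t ≠ 0)
    (ht : v t < 1) (hw : v w < 1) : v t = WithZero.exp (-1 : ℤ) := by
  obtain ⟨h, hh⟩ := hv.exists_val_eq
  have h0 : h ≠ 0 := by
    rintro rfl
    rw [map_zero] at hh
    exact WithZero.exp_ne_zero hh.symm
  obtain ⟨n, e₁, e₂, u₁, u₂, rfl⟩ := hc.exists_zpow_mul_unit hv ht0 ht hw h0
  rw [map_mul, map_zpow₀, map_div₀, hv.val_unitAt ht hw u₁, hv.val_unitAt ht hw u₂, div_one,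
    mul_one] at hh
  have hl := congrArg WithZero.log hh
  rw [WithZero.log_zpow, WithZero.log_exp, smul_eq_mul] at hl
  have h1 := log_neg_of_val_lt_one ht0 ht
  have h2 : WithZero.log (v t) ∣ 1 := ⟨-n, by linarith⟩
  have h3 : WithZero.log (v t) = -1 := by
    rcases Int.isUnit_iff.1 (isUnit_of_dvd_one h2) with h | h <;> omega
  rw [← h3, WithZero.exp_log (by simpa using ht0)]

/-- The normal form `tⁿ` times a unit computes any place centred at the origin of the chart, so only
one such place exists. -/
theorem IsChart.val_unique (hc : IsChart t w) (hv : IsPlace v) (hv' : IsPlace v') (ht0 : t ≠ 0)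
    (ht : v t < 1) (hw : v w < 1) (ht' : v' t < 1) (hw' : v' w < 1) : v = v' := by
  ext h
  by_cases h0 : h = 0
  · simp [h0]
  obtain ⟨n, e₁, e₂, u₁, u₂, rfl⟩ := hc.exists_zpow_mul_unit hv ht0 ht hw h0
  simp only [map_mul, map_zpow₀, map_div₀, hv.val_unitAt ht hw u₁, hv.val_unitAt ht hw u₂,
    hv'.val_unitAt ht' hw' u₁, hv'.val_unitAt ht' hw' u₂, hc.val_param hv ht0 ht hw,
    hc.val_param hv' ht0 ht' hw']

open KaehlerDifferential in
theorem D_mem_adjoin {h : K} (hh : h ∈ Algebra.adjoin ℂ {t, w}) :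
    ∃ h₁ ∈ Algebra.adjoin ℂ {t, w}, ∃ h₂ ∈ Algebra.adjoin ℂ {t, w},
      D ℂ K h = h₁ • D ℂ K t + h₂ • D ℂ K w := by
  induction hh using Algebra.adjoin_induction with
  | mem x hx =>
    rcases hx with rfl | rfl
    · exact ⟨1, one_mem _, 0, zero_mem _, by simp⟩
    · exact ⟨0, zero_mem _, 1, one_mem _, by simp⟩
  | algebraMap r => exact ⟨0, zero_mem _, 0, zero_mem _, by simp⟩
  | add x y _ _ hx hy =>
    obtain ⟨a, ha, b, hb, e⟩ := hx
    obtain ⟨a', ha', b', hb', e'⟩ := hy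
    exact ⟨a + a', add_mem ha ha', b + b', add_mem hb hb', by rw [map_add, e, e']; module⟩
  | mul x y mx my hx hy =>
    obtain ⟨a, ha, b, hb, e⟩ := hx
    obtain ⟨a', ha', b', hb', e'⟩ := hy
    exact ⟨x * a' + y * a, add_mem (mul_mem mx ha') (mul_mem my ha),
      x * b' + y * b, add_mem (mul_mem mx hb') (mul_mem my hb), by
        rw [Derivation.leibniz, e, e']; module⟩

open KaehlerDifferential in
-- Implicit differentiation: in the differential of `w q = t p` the coefficient of `dw` has constant
-- term `q₀ ≠ 0`, so it is a unit and `dw` is a regular multiple of `dt`.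
theorem IsChart.D_of_mem (hc : IsChart t w) (hv : IsPlace v)
    (ht : v t < 1) (hw : v w < 1) {h : K} (hh : h ∈ Algebra.adjoin ℂ {t, w}) :
    ∃ g : K, v g ≤ 1 ∧ D ℂ K h = g • D ℂ K t := by
  obtain ⟨q₀, hq₀, p, hp, q₁, hq₁, q₂, hq₂, rel⟩ := hc.rel
  set q := algebraMap ℂ K q₀ + t * q₁ + w * q₂ with hq
  have uq : UnitAt t w q := ⟨q₀, hq₀, q₁, hq₁, q₂, hq₂, rfl⟩
  obtain ⟨a, ha, b, hb, eq⟩ := D_mem_adjoin uq.mem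
  obtain ⟨a', ha', b', hb', ep⟩ := D_mem_adjoin hp
  have key : (q + w * b - t * b') • D ℂ K w = (p + t * a' - w * a) • D ℂ K t := by
    have := congrArg (D ℂ K) rel
    rw [Derivation.leibniz, Derivation.leibniz, eq, ep] at this
    linear_combination (norm := module) this
  have ur : UnitAt t w (q + w * b - t * b') :=
    ⟨q₀, hq₀, q₁ - b', sub_mem hq₁ hb', q₂ + b, add_mem hq₂ hb, by rw [hq]; ring⟩
  set r := q + w * b - t * b'
  have vr := hv.val_unitAt ht hw ur
  have r0 : r ≠ 0 := by intro h; rw [h] at vr; simp at vr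
  have hw' : D ℂ K w = ((p + t * a' - w * a) / r) • D ℂ K t := by
    rw [div_eq_inv_mul, mul_smul, ← key, smul_smul, inv_mul_cancel₀ r0, one_smul]
  have mt := mem_adjoin_left t w
  have mw := mem_adjoin_right t w
  obtain ⟨c, hcm, d, hd, e⟩ := D_mem_adjoin hh
  refine ⟨c + d * ((p + t * a' - w * a) / r), ?_, by rw [e, hw']; module⟩
  refine v.map_add_le (hv.adjoin_le ht.le hw.le hcm) ?_
  rw [map_mul, map_div₀, vr, div_one, ← map_mul]
  exact hv.adjoin_le ht.le hw.le
    (mul_mem hd (sub_mem (add_mem hp (mul_mem mt ha')) (mul_mem mw ha)))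

open KaehlerDifferential in
theorem D_pow (t : K) (n : ℕ) : D ℂ K (t ^ n) = ((n : ℤ) * t ^ ((n : ℤ) - 1)) • D ℂ K t := by
  rw [Derivation.leibniz_pow]
  cases n with
  | zero => simp
  | succ n => simp [← Nat.cast_smul_eq_nsmul K, smul_smul]

open KaehlerDifferential in
theorem D_zpow (ht0 : t ≠ 0) (n : ℤ) :
    D ℂ K (t ^ n) = ((n : K) * t ^ (n - 1)) • D ℂ K t := by
  obtain ⟨m, rfl | rfl⟩ := n.eq_nat_or_neg
  · simpa using D_pow t m
  · rw [zpow_neg, zpow_natCast, Derivation.leibniz_inv, D_pow, smul_smul]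
    congr 1
    have : -(m : ℤ) - 1 = -((m : ℤ) + (m : ℤ)) + ((m : ℤ) - 1) := by ring
    rw [this, zpow_add₀ ht0, zpow_neg, zpow_add₀ ht0, zpow_natCast]
    push_cast
    field_simp

open KaehlerDifferential in
/-- A function of order `-n ≠ 0` has differential `g dt` with `g` of order one less. -/
theorem IsChart.exists_D_eq (hc : IsChart t w) (hv : IsPlace v) (ht0 : t ≠ 0)
    (ht : v t < 1) (hw : v w < 1) {h : K} (h0 : h ≠ 0) :
    ∃ g : K, D ℂ K h = g • D ℂ K t ∧
      (WithZero.log (v h) ≠ 0 → v g = v h * WithZero.exp (1 : ℤ)) := by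
  obtain ⟨n, e₁, e₂, u₁, u₂, rfl⟩ := hc.exists_zpow_mul_unit hv ht0 ht hw h0
  have v₁ := hv.val_unitAt ht hw u₁
  have v₂ := hv.val_unitAt ht hw u₂
  have vt := hc.val_param hv ht0 ht hw
  have n₂ : e₂ ≠ 0 := by intro h; rw [h] at v₂; simp at v₂
  obtain ⟨g₁, w₁, d₁⟩ := hc.D_of_mem hv ht hw u₁.mem
  obtain ⟨g₂, w₂, d₂⟩ := hc.D_of_mem hv ht hw u₂.mem
  refine ⟨t ^ (n - 1) * (n * (e₁ / e₂) + t * ((e₂ * g₁ - e₁ * g₂) / e₂ ^ 2)), ?_, fun hn => ?_⟩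
  · rw [Derivation.leibniz, D_zpow ht0, Derivation.leibniz_div, d₁, d₂]
    have : t ^ n = t ^ (n - 1) * t := by rw [← zpow_add_one₀ ht0, sub_add_cancel]
    rw [this]
    simp only [smul_smul, ← sub_smul, ← add_smul]
    congr 1
    field_simp
    ring
  · have vh : v (t ^ n * (e₁ / e₂)) = WithZero.exp (-n) := by
      rw [map_mul, map_div₀, v₁, v₂, div_one, mul_one, map_zpow₀, vt, ← WithZero.exp_zsmul]
      simp
    rw [vh, WithZero.log_exp] at hn
    -- In characteristic zero the term `n (e₁ / e₂)` is a unit and dominates the correction, which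
    -- is divisible by `t`.
    have n0 : (n : ℂ) ≠ 0 := by exact_mod_cast (by omega : n ≠ 0)
    have vn : v (n * (e₁ / e₂)) = 1 := by
      rw [map_mul, map_div₀, v₁, v₂, div_one, mul_one, ← hv.map_const n n0, map_intCast (algebraMap ℂ K)]
    have vr : v (t * ((e₂ * g₁ - e₁ * g₂) / e₂ ^ 2)) < 1 := by
      rw [map_mul]
      refine mul_lt_one_of_lt_of_le ht ?_
      rw [map_div₀, map_pow, v₂, one_pow, div_one]
      refine v.map_sub_le ?_ ?_ <;> rw [map_mul]
      · rw [v₂, one_mul]; exact w₁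
      · rw [v₁, one_mul]; exact w₂
    rw [vh, map_mul, v.map_add_eq_of_lt_left (by rwa [vn]), vn, mul_one, map_zpow₀, vt,
      ← WithZero.exp_zsmul, ← WithZero.exp_add]
    congr 1
    simp
    ring

end LocalTheory

end BringCurve

namespace BringCurve

/-! ### Existence of places and residues in `ℂ` -/

section Existence

variable {K : Type*} [Field K] [Algebra ℂ K]

theorem inv_notMem_adjoin {u : K} (hu : Transcendental ℂ u) : u⁻¹ ∉ Algebra.adjoin ℂ {u} := by
  rw [Algebra.adjoin_singleton_eq_range_aeval]
  rintro ⟨p, hp⟩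
  have u0 : u ≠ 0 := by rintro rfl; exact hu (isAlgebraic_zero)
  have h : aeval u (X * p - 1) = 0 := by
    simp only [map_sub, map_mul, aeval_X, map_one]
    rw [show (aeval u) p = u⁻¹ from hp, mul_inv_cancel₀ u0, sub_self]
  have h' := (transcendental_iff.1 hu) _ h
  exact X_mul_ne_one p (sub_eq_zero.1 h')

theorem mem_adjoin_adjoin {u w : K} (htop : IntermediateField.adjoin ℂ {u, w} = ⊤) (z : K) :
    z ∈ IntermediateField.adjoin (IntermediateField.adjoin ℂ {u}) {w} := by
  have hz : z ∈ IntermediateField.adjoin ℂ {u, w} := by rw [htop]; trivial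
  have hle : IntermediateField.adjoin ℂ {u, w} ≤
      (IntermediateField.adjoin (IntermediateField.adjoin ℂ {u}) {w}).restrictScalars ℂ := by
    rw [IntermediateField.adjoin_le_iff]
    rintro a (rfl | rfl)
    · exact (IntermediateField.adjoin (IntermediateField.adjoin ℂ {a}) {w}).algebraMap_mem
        ⟨a, IntermediateField.mem_adjoin_simple_self ℂ a⟩
    · exact IntermediateField.mem_adjoin_simple_self _ a
  exact hle hz

/-- A transcendental function has a zero. -/
theorem exists_isPlace_val_lt_one {u w : K} (hu : Transcendental ℂ u)
    (hw : IsIntegral (IntermediateField.adjoin ℂ {u}) w)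
    (htop : IntermediateField.adjoin ℂ {u, w} = ⊤) :
    ∃ v : Valuation K (WithZero (Multiplicative ℤ)), IsPlace v ∧ v u < 1 := by
  classical
  -- The integral closure `B` of `ℂ[u]` in `K` is a Dedekind domain. If `u` were a unit of `B`, then
  -- `u⁻¹` would be integral over the integrally closed ring `ℂ[u]` and hence lie in it. So some
  -- maximal ideal of `B` contains `u`, and its valuation is the required place.
  open scoped IntermediateField.algebraAdjoinAdjoin in
  let A := Algebra.adjoin ℂ {u}
  let F := IntermediateField.adjoin ℂ {u}
  have : IsPrincipalIdealRing A := by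
    have e : ℂ[X] ≃ₐ[ℂ] A := (AlgEquiv.ofInjective (aeval u)
      (transcendental_iff_injective.1 hu)).trans
        (Subalgebra.equivOfEq _ _ (Algebra.adjoin_singleton_eq_range_aeval ℂ u).symm)
    exact IsPrincipalIdealRing.of_surjective e.toRingEquiv.toRingHom e.surjective
  have hFtop : IntermediateField.adjoin F {w} = ⊤ := by
    exact eq_top_iff.2 fun z _ => mem_adjoin_adjoin htop z
  have : FiniteDimensional F K := by
    have h1 : FiniteDimensional F (IntermediateField.adjoin F {w}) :=
      IntermediateField.adjoin.finiteDimensional hw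
    rw [hFtop] at h1
    exact Module.Finite.equiv (IntermediateField.topEquiv (F := F) (E := K)).toLinearEquiv
  let B := integralClosure A K
  have : IsDedekindDomain B := integralClosure.isDedekindDomain A F K
  have : IsFractionRing B K := integralClosure.isFractionRing_of_finite_extension F K
  let uB : B := algebraMap A B ⟨u, Algebra.self_mem_adjoin_singleton ℂ u⟩
  have huB : algebraMap B K uB = u := rfl
  have u0 : u ≠ 0 := by rintro rfl; exact hu isAlgebraic_zero
  have hnu : ¬ IsUnit uB := by
    intro h
    obtain ⟨b, hb⟩ := h.exists_right_inv
    have hb' : (b : K) = u⁻¹ := by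
      have := congrArg (algebraMap B K) hb
      rw [map_mul, huB, map_one] at this
      exact eq_inv_of_mul_eq_one_right this
    have hi : IsIntegral A (u⁻¹ : K) := hb' ▸ b.2
    have huF : u ∈ F := IntermediateField.mem_adjoin_simple_self ℂ u
    have hi' : IsIntegral A (⟨u⁻¹, inv_mem huF⟩ : F) :=
      (isIntegral_algHom_iff (IsScalarTower.toAlgHom A F K) Subtype.val_injective).1 hi
    obtain ⟨a, ha⟩ := (IsIntegrallyClosed.isIntegral_iff (R := A) (K := F)).1 hi'
    refine inv_notMem_adjoin hu ?_
    have : (a : K) = u⁻¹ := congrArg Subtype.val ha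
    rw [← this]
    exact a.2
  obtain ⟨m, hm, hum⟩ := exists_max_ideal_of_mem_nonunits hnu
  have uB0 : uB ≠ 0 := by
    intro h; rw [h, map_zero] at huB; exact u0 huB.symm
  let P : IsDedekindDomain.HeightOneSpectrum B :=
    ⟨m, hm.isPrime, fun h => uB0 (by rw [h] at hum; exact hum)⟩
  have hle : ∀ z : ℂ, P.valuation K (algebraMap ℂ K z) ≤ 1 := fun z =>
    P.valuation_le_one (algebraMap ℂ B z)
  refine ⟨P.valuation K, ⟨P.valuation_surjective K, fun z hz => le_antisymm (hle z) ?_⟩, ?_⟩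
  · have h := hle z⁻¹
    have hz' : algebraMap ℂ K z ≠ 0 := by simpa using hz
    rw [map_inv₀, map_inv₀] at h
    exact (inv_le_one₀ (by simpa [zero_lt_iff] using hz)).1 h
  · exact (P.valuation_lt_one_iff_mem uB).2 hum

variable {v : Valuation K (WithZero (Multiplicative ℤ))}

theorem IsPlace.val_sub_const_le (hv : IsPlace v) {h : K} (hh : v h ≤ 1) (c : ℂ) :
    v (h - algebraMap ℂ K c) ≤ 1 :=
  v.map_sub_le hh (hv.const_le c)

/-- If a nonzero polynomial in `h` vanishes at a place, then `h` has a value in `ℂ` there. -/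
theorem IsPlace.exists_const_of_aeval (hv : IsPlace v) {h : K} (hh : v h ≤ 1) {p : ℂ[X]}
    (p0 : p ≠ 0) (hp : v (aeval h p) < 1) : ∃ c : ℂ, v (h - algebraMap ℂ K c) < 1 := by
  by_contra! hc
  have hc' : ∀ c : ℂ, v (h - algebraMap ℂ K c) = 1 := fun c =>
    le_antisymm (hv.val_sub_const_le hh c) (hc c)
  -- Over `ℂ` the polynomial splits; if no `h - c` had valuation below one, the whole product would
  -- have valuation one.
  rw [(IsAlgClosed.splits p).eq_prod_roots] at hp
  simp only [map_mul, aeval_C, hv.map_const _ (leadingCoeff_ne_zero.2 p0), one_mul] at hp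
  rw [map_multiset_prod, Multiset.map_map, map_multiset_prod, Multiset.map_map] at hp
  refine hp.ne (Multiset.prod_eq_one ?_)
  intro a ha
  obtain ⟨c, -, rfl⟩ := Multiset.mem_map.1 ha
  simpa using hc' c

/-- If every `u - c` had valuation one, so would every nonzero polynomial in `u`. Then `v ≤ 1` on
`ℂ(u)`, hence on its integral extension `K`, contradicting surjectivity of `v`. -/
theorem IsPlace.exists_const (hv : IsPlace v) {u w : K}
    (hw : IsIntegral (IntermediateField.adjoin ℂ {u}) w)
    (htop : IntermediateField.adjoin ℂ {u, w} = ⊤) (hu1 : v u ≤ 1) :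
    ∃ c : ℂ, v (u - algebraMap ℂ K c) < 1 := by
  by_contra! hc
  have haeval : ∀ p : ℂ[X], p ≠ 0 → v (aeval u p) = 1 := by
    intro p p0
    refine le_antisymm ?_ (not_lt.1 fun h => ?_)
    · rw [aeval_eq_sum_range]
      refine v.map_sum_le fun i _ => ?_
      rw [Algebra.smul_def, map_mul, map_pow]
      exact mul_le_one' (hv.const_le _) (pow_le_one' hu1 i)
    · obtain ⟨c, hc'⟩ := hv.exists_const_of_aeval hu1 p0 h
      exact absurd hc' (not_lt.2 (hc c))
  let F := IntermediateField.adjoin ℂ {u}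
  have hF : ∀ z : F, v z ≤ 1 := by
    rintro ⟨z, hz⟩
    obtain ⟨r, s, rfl⟩ := (IntermediateField.mem_adjoin_simple_iff ℂ z).1 hz
    simp only
    by_cases s0 : s = 0
    · simp [s0]
    by_cases r0 : r = 0
    · simp [r0]
    rw [map_div₀, haeval r r0, haeval s s0, div_one]
  have halg : ∀ z : K, v z ≤ 1 := by
    intro z
    have h1 : FiniteDimensional F (IntermediateField.adjoin F {w}) :=
      IntermediateField.adjoin.finiteDimensional hw
    have hi : IsIntegral F z :=
      (Algebra.IsIntegral.isIntegral (R := F)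
        (⟨z, mem_adjoin_adjoin htop z⟩ : IntermediateField.adjoin F {w})).map
        (IntermediateField.adjoin F {w}).val
    let φ : F →+* v.integer := (algebraMap F K).codRestrict v.integer hF
    have hi' : IsIntegral v.integer z := by
      obtain ⟨p, pm, hp⟩ := hi
      refine ⟨p.map φ, pm.map φ, ?_⟩
      rw [eval₂_map]
      exact hp
    exact (Valuation.integer.integers v).mem_of_integral hi'
  obtain ⟨h, hh⟩ := hv.surjective (WithZero.exp (1 : ℤ))
  have := halg h
  rw [hh, ← WithZero.exp_zero, WithZero.exp_le_exp] at this
  omega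

end Existence

end BringCurve

namespace BringCurve

/-! ### The equation in the ruling coordinates and its charts -/

section Algebra

variable {K : Type*} [Field K]

theorem quadric_coords_rel {x y : K} (hf : x * (y ^ 5 + 1) + (x * y) ^ 2 - x ^ 4 * y - 2 * y ^ 3 = 0)
    {U W : K} (hD : y ^ 3 - x ≠ 0) (hU : U * (y ^ 3 - x) = y - x ^ 2) (hW : W = y * U) :
    U * (1 - U ^ 2 * W) = W ^ 2 * (1 + U ^ 2 * W) := by
  obtain rfl : U = (y - x ^ 2) / (y ^ 3 - x) := by rw [← hU, mul_div_cancel_right₀ _ hD]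
  subst hW
  rw [← sub_eq_zero]
  -- After clearing denominators, the difference of the two sides is an explicit multiple of the
  -- sextic.
  have : (y - x ^ 2) / (y ^ 3 - x) * (1 - ((y - x ^ 2) / (y ^ 3 - x)) ^ 2 *
      (y * ((y - x ^ 2) / (y ^ 3 - x)))) - (y * ((y - x ^ 2) / (y ^ 3 - x))) ^ 2 *
      (1 + ((y - x ^ 2) / (y ^ 3 - x)) ^ 2 * (y * ((y - x ^ 2) / (y ^ 3 - x)))) =
      (y - x ^ 2) * ((x * (y ^ 5 + 1) + (x * y) ^ 2 - x ^ 4 * y - 2 * y ^ 3) *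
      ((y ^ 3 - x) * (y - x ^ 2) + 2 * y * (y ^ 3 - x) * (y ^ 2 * x - 1) -
        y * (x * (y ^ 5 + 1) + (x * y) ^ 2 - x ^ 4 * y - 2 * y ^ 3))) / (y ^ 3 - x) ^ 5 := by
    field_simp
    ring
  rw [this, hf]
  simp

/-- Together with `y = W / U` this inverts the passage to `U, W`, so these two functions generate
the function field. -/
theorem quadric_coords_x {x y : K} (hf : x * (y ^ 5 + 1) + (x * y) ^ 2 - x ^ 4 * y - 2 * y ^ 3 = 0)
    {U W : K} (hD : y ^ 3 - x ≠ 0) (hU : U * (y ^ 3 - x) = y - x ^ 2) (hW : W = y * U) :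
    x * (W ^ 2 + U ^ 3 * W) = U ^ 2 + W ^ 4 := by
  obtain rfl : U = (y - x ^ 2) / (y ^ 3 - x) := by rw [← hU, mul_div_cancel_right₀ _ hD]
  subst hW
  rw [← sub_eq_zero]
  have : x * ((y * ((y - x ^ 2) / (y ^ 3 - x))) ^ 2 + ((y - x ^ 2) / (y ^ 3 - x)) ^ 3 *
      (y * ((y - x ^ 2) / (y ^ 3 - x)))) - (((y - x ^ 2) / (y ^ 3 - x)) ^ 2 +
      (y * ((y - x ^ 2) / (y ^ 3 - x))) ^ 4) =
      (y - x ^ 2) ^ 2 * ((y ^ 3 - x) *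
        (x * (y ^ 5 + 1) + (x * y) ^ 2 - x ^ 4 * y - 2 * y ^ 3)) / (y ^ 3 - x) ^ 4 := by
    field_simp
    ring
  rw [this, hf]
  simp

/-- On numerators `v₁ v₂ + v₃ v₄` is the sextic itself; this is the quadric relation divided by
`v₁`. -/
theorem vNum_one_rel {x y : K} (hf : x * (y ^ 5 + 1) + (x * y) ^ 2 - x ^ 4 * y - 2 * y ^ 3 = 0)
    {U W : K} (hD : y ^ 3 - x ≠ 0) (hU : U * (y ^ 3 - x) = y - x ^ 2) (hW : W = y * U) :
    y ^ 2 * x - 1 = U * W * (y ^ 3 - x) := by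
  obtain rfl : U = (y - x ^ 2) / (y ^ 3 - x) := by rw [← hU, mul_div_cancel_right₀ _ hD]
  subst hW
  field_simp
  linear_combination hf

variable [Algebra ℂ K] {U W : K}

theorem adjoin_eq_top_of_mem {t w : K} (h : IntermediateField.adjoin ℂ {U, W} = ⊤)
    (hU : U ∈ IntermediateField.adjoin ℂ {t, w}) (hW : W ∈ IntermediateField.adjoin ℂ {t, w}) :
    IntermediateField.adjoin ℂ {t, w} = ⊤ := by
  rw [eq_top_iff, ← h, IntermediateField.adjoin_le_iff]
  rintro a (rfl | rfl) <;> assumption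

theorem mem_field_left (t w : K) : t ∈ IntermediateField.adjoin ℂ {t, w} :=
  IntermediateField.subset_adjoin ℂ _ (by simp)

theorem mem_field_right (t w : K) : w ∈ IntermediateField.adjoin ℂ {t, w} :=
  IntermediateField.subset_adjoin ℂ _ (by simp)

variable (htop : IntermediateField.adjoin ℂ {U, W} = ⊤) (hU : U ≠ 0) (hW : W ≠ 0)
  (hrel : U * (1 - U ^ 2 * W) = W ^ 2 * (1 + U ^ 2 * W))

include htop hrel in
-- The curve passes through the four corners of `ℙ¹ × ℙ¹`. At each one the equation has a nonzero
-- linear term in a single variable, which becomes the dependent variable `w` of the chart.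
theorem isChart_zero_zero : IsChart W U := by
  have mt := mem_adjoin_left W U
  have mw := mem_adjoin_right W U
  refine ⟨adjoin_eq_top_of_mem htop (mem_field_right _ _) (mem_field_left _ _), 1, one_ne_zero,
    W, mt, -U ^ 2 - U * W ^ 2, ?_, 0, zero_mem _, ?_⟩
  · exact sub_mem (neg_mem (pow_mem mw 2)) (mul_mem mw (pow_mem mt 2))
  · rw [map_one]; linear_combination hrel

include htop hU hW hrel in
theorem isChart_inf_inf : IsChart W⁻¹ U⁻¹ := by
  have mt := mem_adjoin_left W⁻¹ U⁻¹
  have mw := mem_adjoin_right W⁻¹ U⁻¹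
  refine ⟨adjoin_eq_top_of_mem htop ?_ ?_, -1, by norm_num,
    W⁻¹, mt, W⁻¹ ^ 2 * U⁻¹, ?_, -(W⁻¹ * U⁻¹), ?_, ?_⟩
  · simpa using inv_mem (mem_field_right W⁻¹ U⁻¹)
  · simpa using inv_mem (mem_field_left W⁻¹ U⁻¹)
  · exact mul_mem (pow_mem mt 2) mw
  · exact neg_mem (mul_mem mt mw)
  · rw [map_neg, map_one]
    field_simp
    linear_combination hrel

include htop hW hrel in
theorem isChart_zero_inf : IsChart U W⁻¹ := by
  have mt := mem_adjoin_left U W⁻¹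
  have mw := mem_adjoin_right U W⁻¹
  refine ⟨adjoin_eq_top_of_mem htop (mem_field_left _ _) ?_, -1, by norm_num,
    U, mt, W⁻¹ ^ 2 - U ^ 2 * W⁻¹, ?_, 0, zero_mem _, ?_⟩
  · simpa using inv_mem (mem_field_right U W⁻¹)
  · exact sub_mem (pow_mem mw 2) (mul_mem (pow_mem mt 2) mw)
  · rw [map_neg, map_one]
    field_simp
    linear_combination hrel

include htop hU hrel in
theorem isChart_inf_zero : IsChart U⁻¹ W := by
  have mt := mem_adjoin_left U⁻¹ W
  have mw := mem_adjoin_right U⁻¹ W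
  refine ⟨adjoin_eq_top_of_mem htop ?_ (mem_field_right _ _), 1, by norm_num,
    U⁻¹, mt, W * U⁻¹ ^ 2, ?_, W * U⁻¹, ?_, ?_⟩
  · simpa using inv_mem (mem_field_left U⁻¹ W)
  · exact mul_mem mw (pow_mem mt 2)
  · exact mul_mem mw mt
  · rw [map_one]
    field_simp
    linear_combination -hrel

include htop hU in
theorem adjoin_kummer : IntermediateField.adjoin ℂ {U ^ 2 * W, U} = ⊤ := by
  have mt := mem_field_left (U ^ 2 * W) U
  have mw := mem_field_right (U ^ 2 * W) U
  refine adjoin_eq_top_of_mem htop mw ?_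
  simpa [hU] using div_mem mt (pow_mem mw 2)

omit [Algebra ℂ K] in
include hrel in
theorem kummer_rel : U ^ 5 * (1 - U ^ 2 * W) = (U ^ 2 * W) ^ 2 * (1 + U ^ 2 * W) := by
  linear_combination U ^ 4 * hrel

include htop hU hrel in
-- The derivative of `U⁵ (1 - s) - s² (1 + s)` with respect to `U` is `5 u⁴ (1 - c) ≠ 0` at `(c,
-- u)`, so `s - c` is a parameter.
theorem isChart_kummer {c u : ℂ} (hu : u ≠ 0) (hc : 1 - c ≠ 0)
    (h : u ^ 5 * (1 - c) = c ^ 2 * (1 + c)) :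
    IsChart (U ^ 2 * W - algebraMap ℂ K c) (U - algebraMap ℂ K u) := by
  have hk := kummer_rel hrel
  have htop' := adjoin_kummer htop hU
  set s := U ^ 2 * W with hs
  set c' := algebraMap ℂ K c with hc'
  set u' := algebraMap ℂ K u with hu'
  have h' : u' ^ 5 * (1 - c') = c' ^ 2 * (1 + c') := by
    have := congrArg (algebraMap ℂ K) h
    simpa using this
  have mt := mem_adjoin_left (s - c') (U - u')
  have mw := mem_adjoin_right (s - c') (U - u')
  have mc : ∀ z : ℂ, algebraMap ℂ K z ∈ Algebra.adjoin ℂ {s - c', U - u'} :=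
    fun z => Subalgebra.algebraMap_mem _ z
  have ms : s ∈ Algebra.adjoin ℂ {s - c', U - u'} := by 
    have := add_mem mt (mc c)
    rwa [sub_add_cancel] at this
  have mU : U ∈ Algebra.adjoin ℂ {s - c', U - u'} := by 
    have := add_mem mw (mc u)
    rwa [sub_add_cancel] at this
  -- The cofactors are difference quotients, from `U⁵ - u⁵ = (U - u) (5u⁴ + (U - u) (U³ + 2U²u +
  -- 3Uu² + 4u³))` and the analogous division of `s² + s³` by `s - c`.
  refine ⟨adjoin_eq_top_of_mem htop' ?_ ?_, 5 * u ^ 4 * (1 - c), by simp [hu, hc],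
    U ^ 5 + (s + c') + (s ^ 2 + s * c' + c' ^ 2), ?_, 0, zero_mem _,
    (1 - c') * (U ^ 3 + 2 * U ^ 2 * u' + 3 * U * u' ^ 2 + 4 * u' ^ 3), ?_, ?_⟩
  · have := add_mem (mem_field_left (s - c') (U - u'))
      ((IntermediateField.adjoin ℂ {s - c', U - u'}).algebraMap_mem c)
    rwa [sub_add_cancel] at this
  · have := add_mem (mem_field_right (s - c') (U - u'))
      ((IntermediateField.adjoin ℂ {s - c', U - u'}).algebraMap_mem u)
    rwa [sub_add_cancel] at this
  · exact add_mem (add_mem (pow_mem mU 5) (add_mem ms (mc c)))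
      (add_mem (add_mem (pow_mem ms 2) (mul_mem ms (mc c))) (pow_mem (mc c) 2))
  · exact mul_mem (sub_mem (one_mem _) (mc c)) (add_mem (add_mem (add_mem (pow_mem mU 3)
      (mul_mem (mul_mem (ofNat_mem _ 2) (pow_mem mU 2)) (mc u)))
      (mul_mem (mul_mem (ofNat_mem _ 3) mU) (pow_mem (mc u) 2)))
      (mul_mem (ofNat_mem _ 4) (pow_mem (mc u) 3)))
  · simp only [map_mul, map_sub, map_one, map_pow, map_ofNat, ← hc', ← hu']
    linear_combination hk - h'

include hrel in
theorem isIntegral_kummer {F : IntermediateField ℂ K} (hs : U ^ 2 * W ∈ F) (h1 : 1 - U ^ 2 * W ≠ 0) :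
    IsIntegral F U := by
  have hk := kummer_rel hrel
  set s := U ^ 2 * W
  refine IsIntegral.of_pow (n := 5) (by norm_num) ?_
  have : U ^ 5 = s ^ 2 * (1 + s) / (1 - s) := by rw [← hk, mul_div_cancel_right₀ _ h1]
  rw [this]
  exact isIntegral_algebraMap (R := F) (x := ⟨s ^ 2 * (1 + s) / (1 - s),
    div_mem (mul_mem (pow_mem hs 2) (add_mem (one_mem _) hs)) (sub_mem (one_mem _) hs)⟩)

end Algebra

end BringCurve

/-! ### The function field and its generators `rulU`, `rulW`, `cyc` -/

namespace BringCurve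

instance : CharZero FunctionField :=
  charZero_of_injective_algebraMap (algebraMap ℂ FunctionField).injective

theorem curve_eq : x * (y ^ 5 + 1) + (x * y) ^ 2 - x ^ 4 * y - 2 * y ^ 3 = 0 := by
  have h : AdjoinRoot.mk hcPoly
      (X * (C X ^ 5 + 1) + (X * C X) ^ 2 - X ^ 4 * C X - 2 * C X ^ 3) = 0 := AdjoinRoot.mk_self
  have h' := congrArg (algebraMap (AdjoinRoot hcPoly) FunctionField) h
  simp only [map_add, map_sub, map_mul, map_pow, map_one, map_ofNat, AdjoinRoot.mk_X,
    AdjoinRoot.mk_C, map_zero] at h'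
  exact h'

theorem aeval_y (p : ℂ[X]) :
    aeval y p = algebraMap (AdjoinRoot hcPoly) FunctionField (AdjoinRoot.of hcPoly p) := by
  induction p using Polynomial.induction_on' with
  | add p q hp hq => simp only [map_add, hp, hq]
  | monomial n a =>
    rw [← C_mul_X_pow_eq_monomial]
    simp only [map_mul, map_pow, aeval_X, aeval_C]
    rfl

theorem transcendental_y : Transcendental ℂ y := by
  rw [transcendental_iff]
  intro p hp
  rw [aeval_y] at hp
  have h1 : AdjoinRoot.of hcPoly p = 0 :=
    (IsFractionRing.injective (AdjoinRoot hcPoly) FunctionField) (by rw [hp, map_zero])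
  have h2 : AdjoinRoot.mk hcPoly (C p) = 0 := h1
  rw [AdjoinRoot.mk_eq_zero] at h2
  by_contra p0
  have h3 := natDegree_le_of_dvd h2 (C_ne_zero.2 p0)
  rw [hcPoly_natDegree, natDegree_C] at h3
  omega

theorem y_ne_zero : y ≠ 0 := fun h => transcendental_y (h ▸ isAlgebraic_zero)

theorem isAlgebraic_of_pow_eq_one {z : FunctionField} (h : z ^ 5 = 1) : IsAlgebraic ℂ z :=
  IsAlgebraic.of_pow (n := 5) (by norm_num) (h ▸ isAlgebraic_one)

/-- Putting `x = y³` in the sextic leaves `-y³ (y⁵ - 1)²`, which would make `y` algebraic. -/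
theorem y_cube_sub_x_ne_zero : y ^ 3 - x ≠ 0 := by
  intro h
  have hx : x = y ^ 3 := (sub_eq_zero.1 h).symm
  have hf := curve_eq
  rw [hx] at hf
  have h1 : y ^ 3 * (y ^ 5 - 1) ^ 2 = 0 := by linear_combination -hf
  rcases mul_eq_zero.1 h1 with h2 | h2
  · exact y_ne_zero (pow_eq_zero_iff (by norm_num) |>.1 h2)
  · exact transcendental_y
      (isAlgebraic_of_pow_eq_one (sub_eq_zero.1 (pow_eq_zero_iff (by norm_num) |>.1 h2)))

theorem y_sub_x_sq_ne_zero : y - x ^ 2 ≠ 0 := by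
  intro h
  have hy : y = x ^ 2 := sub_eq_zero.1 h
  have hf := curve_eq
  have h1 : x * (x ^ 5 - 1) ^ 2 = 0 := by
    rw [hy] at hf
    linear_combination hf
  have hx : IsAlgebraic ℂ x := by
    rcases mul_eq_zero.1 h1 with h2 | h2
    · exact h2 ▸ isAlgebraic_zero
    · exact isAlgebraic_of_pow_eq_one (sub_eq_zero.1 (pow_eq_zero_iff (by norm_num) |>.1 h2))
  exact transcendental_y (hy ▸ hx.pow 2)

/-- The first ruling coordinate `v₃ / v₁`. -/
noncomputable def rulU : FunctionField := (y - x ^ 2) / (y ^ 3 - x)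

/-- The second ruling coordinate `v₂ / v₃ = - v₄ / v₁`. -/
noncomputable def rulW : FunctionField := y * rulU

theorem rulU_mul : rulU * (y ^ 3 - x) = y - x ^ 2 := div_mul_cancel₀ _ y_cube_sub_x_ne_zero

theorem rulU_ne_zero : rulU ≠ 0 := div_ne_zero y_sub_x_sq_ne_zero y_cube_sub_x_ne_zero

theorem rulW_ne_zero : rulW ≠ 0 := mul_ne_zero y_ne_zero rulU_ne_zero

theorem rul_rel :
    rulU * (1 - rulU ^ 2 * rulW) = rulW ^ 2 * (1 + rulU ^ 2 * rulW) :=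
  quadric_coords_rel curve_eq y_cube_sub_x_ne_zero rulU_mul rfl

theorem y_eq : y = rulW / rulU := by
  rw [rulW, mul_div_cancel_right₀ _ rulU_ne_zero]

theorem x_mul : x * (rulW ^ 2 + rulU ^ 3 * rulW) = rulU ^ 2 + rulW ^ 4 :=
  quadric_coords_x curve_eq y_cube_sub_x_ne_zero rulU_mul rfl

/-- The degree five function `u² w`. -/
noncomputable def cyc : FunctionField := rulU ^ 2 * rulW

theorem cyc_eq : cyc = rulU ^ 2 * rulW := rfl

theorem cyc_rel : rulU ^ 5 * (1 - cyc) = cyc ^ 2 * (1 + cyc) := kummer_rel rul_rel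

/-- Algebraicity would pass from `s` to `U` by the Kummer equation, then to `W = s / U²` and to `y =
W / U`. -/
theorem transcendental_cyc : Transcendental ℂ cyc := by
  intro h
  have hU : IsAlgebraic ℂ rulU := by
    by_cases h1 : 1 - cyc = 0
    · have := cyc_rel
      have hc : cyc = 1 := (sub_eq_zero.1 h1).symm
      rw [hc] at this
      have h2 : (2 : FunctionField) = 0 := by linear_combination -this
      exact absurd h2 two_ne_zero
    · refine IsAlgebraic.of_pow (n := 5) (by norm_num) ?_
      have : rulU ^ 5 = cyc ^ 2 * (1 + cyc) * (1 - cyc)⁻¹ := by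
        rw [← cyc_rel, mul_inv_cancel_right₀ h1]
      rw [this]
      exact ((h.pow 2).mul (isAlgebraic_one.add h)).mul (isAlgebraic_one.sub h).inv
  have hW : IsAlgebraic ℂ rulW := by
    have : rulW = cyc * (rulU ^ 2)⁻¹ := by
      rw [cyc_eq]; field_simp [rulU_ne_zero]
    rw [this]
    exact h.mul (hU.pow 2).inv
  refine transcendental_y ?_
  rw [y_eq, div_eq_mul_inv]
  exact hW.mul hU.inv

theorem cyc_sub_const_ne_zero (c : ℂ) : cyc - algebraMap ℂ FunctionField c ≠ 0 := fun h =>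
  transcendental_cyc ((sub_eq_zero.1 h) ▸ isAlgebraic_algebraMap c)

theorem cyc_ne_zero : cyc ≠ 0 := by simpa using cyc_sub_const_ne_zero 0

theorem one_sub_cyc_ne_zero : 1 - cyc ≠ 0 := by
  rw [← neg_ne_zero]
  simpa using cyc_sub_const_ne_zero 1

theorem one_add_cyc_ne_zero : 1 + cyc ≠ 0 := by
  simpa [add_comm] using cyc_sub_const_ne_zero (-1)

theorem x_denom_ne_zero : rulW ^ 2 + rulU ^ 3 * rulW ≠ 0 := by
  intro h
  have h1 : rulW = -rulU ^ 3 := by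
    have : rulW * (rulW + rulU ^ 3) = 0 := by linear_combination h
    exact eq_neg_of_add_eq_zero_left ((mul_eq_zero.1 this).resolve_left rulW_ne_zero)
  have h2 := x_mul
  rw [h, mul_zero, h1] at h2
  have h3 : rulU ^ 2 * (1 + rulU ^ 10) = 0 := by linear_combination -h2
  have h4 : rulU ^ 10 = -1 := by
    have := (mul_eq_zero.1 h3).resolve_left (pow_ne_zero 2 rulU_ne_zero)
    linear_combination this
  refine transcendental_cyc ?_
  have hU : IsAlgebraic ℂ rulU :=
    IsAlgebraic.of_pow (n := 10) (by norm_num) (h4 ▸ isAlgebraic_one.neg)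
  rw [cyc_eq, h1]
  exact (hU.pow 2).mul (hU.pow 3).neg

theorem x_eq : x = (rulU ^ 2 + rulW ^ 4) / (rulW ^ 2 + rulU ^ 3 * rulW) := by
  rw [← x_mul, mul_div_cancel_right₀ _ x_denom_ne_zero]

theorem mem_of_x_y_mem {E : IntermediateField ℂ FunctionField} (hx : x ∈ E) (hy : y ∈ E)
    (z : FunctionField) : z ∈ E := by
  have hmk : ∀ a : AdjoinRoot hcPoly, algebraMap (AdjoinRoot hcPoly) FunctionField a ∈ E := by
    intro a
    obtain ⟨p, rfl⟩ := AdjoinRoot.mk_surjective a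
    induction p using Polynomial.induction_on' with
    | add p q hp hq => simp only [map_add]; exact add_mem hp hq
    | monomial n c =>
      rw [← C_mul_X_pow_eq_monomial]
      simp only [map_mul, map_pow, AdjoinRoot.mk_X, AdjoinRoot.mk_C]
      refine mul_mem ?_ (pow_mem hx n)
      rw [← aeval_y]
      have := (Algebra.adjoin_le_iff (S := E.toSubalgebra) (s := {y})).2 (by simpa using hy)
      exact this (aeval_mem_adjoin_singleton ℂ y)
  obtain ⟨a, b, -, rfl⟩ := IsFractionRing.div_surjective (A := AdjoinRoot hcPoly) z
  exact div_mem (hmk a) (hmk b)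

theorem adjoin_rul : IntermediateField.adjoin ℂ {rulU, rulW} = ⊤ := by
  have mt := mem_field_left rulU rulW
  have mw := mem_field_right rulU rulW
  refine eq_top_iff.2 fun z _ => mem_of_x_y_mem ?_ ?_ z
  · rw [x_eq]
    exact div_mem (add_mem (pow_mem mt 2) (pow_mem mw 4))
      (add_mem (pow_mem mw 2) (mul_mem (pow_mem mt 3) mw))
  · rw [y_eq]
    exact div_mem mw mt

/-- Without nonzero differentials the function field would be unramified and essentially of finite
type over `ℂ`, hence algebraic. The chart computations only express differentials through `dt`; this
is what makes `dt` nonzero. -/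
theorem nontrivial_kaehler : ∃ h : FunctionField, KaehlerDifferential.D ℂ FunctionField h ≠ 0 := by
  by_contra! h
  have hsub : Subsingleton (Ω[FunctionField⁄ℂ]) := by
    have hs := KaehlerDifferential.span_range_derivation ℂ FunctionField
    rw [Submodule.span_eq_bot.2 (by rintro _ ⟨z, rfl⟩; exact h z)] at hs
    exact (Submodule.subsingleton_iff FunctionField).1 (subsingleton_of_bot_eq_top hs)
  have : Algebra.FormallyUnramified ℂ FunctionField := ⟨hsub⟩
  have : Algebra.EssFiniteType (AdjoinRoot hcPoly) FunctionField :=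
    .of_isLocalization _ (nonZeroDivisors (AdjoinRoot hcPoly))
  have : Algebra.EssFiniteType ℂ FunctionField :=
    .comp ℂ (AdjoinRoot hcPoly) FunctionField
  have : Algebra.IsSeparable ℂ FunctionField :=
    (Algebra.FormallyUnramified.iff_isSeparable ℂ FunctionField).1 inferInstance
  exact transcendental_y (Algebra.IsAlgebraic.isAlgebraic y)

end BringCurve

namespace BringCurve

/-! ### Orders and values of functions at a point -/

namespace Point

variable (P : Point)

theorem isPlace : IsPlace P.val := ⟨P.surjective, P.trivial_on_const⟩

variable {P}
variable {f g : FunctionField}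

theorem val_ne_zero (hf : f ≠ 0) : P.val f ≠ 0 := by simpa using hf

theorem ord_mul (hf : f ≠ 0) (hg : g ≠ 0) : P.ord (f * g) = P.ord f + P.ord g := by
  simp only [ord, map_mul, WithZero.log_mul (val_ne_zero hf) (val_ne_zero hg)]
  ring

theorem ord_pow (n : ℕ) : P.ord (f ^ n) = n * P.ord f := by
  simp only [ord, map_pow, WithZero.log_pow, nsmul_eq_mul]
  ring

theorem ord_inv : P.ord f⁻¹ = -P.ord f := by
  simp only [ord, map_inv₀, WithZero.log_inv]

theorem ord_zpow (n : ℤ) : P.ord (f ^ n) = n * P.ord f := by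
  simp only [ord, map_zpow₀, WithZero.log_zpow, smul_eq_mul]
  ring

theorem ord_div (hf : f ≠ 0) (hg : g ≠ 0) : P.ord (f / g) = P.ord f - P.ord g := by
  rw [div_eq_mul_inv, ord_mul hf (inv_ne_zero hg), ord_inv]
  ring

theorem ord_neg : P.ord (-f) = P.ord f := by
  simp only [ord, Valuation.map_neg]

theorem ord_pos_iff (hf : f ≠ 0) : 0 < P.ord f ↔ P.val f < 1 := by
  rw [ord, neg_pos, WithZero.log_lt_iff_lt_exp (val_ne_zero hf), WithZero.exp_zero]

theorem val_lt_one_of_ord_pos (h : 0 < P.ord f) : P.val f < 1 := by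
  -- The convention `ord 0 = 0` lets a positive order exclude `f = 0`.
  refine (ord_pos_iff ?_).1 h
  rintro rfl
  simp [ord] at h

theorem ord_nonneg_iff (hf : f ≠ 0) : 0 ≤ P.ord f ↔ P.val f ≤ 1 := by
  rw [ord, Left.nonneg_neg_iff, WithZero.log_le_iff_le_exp (val_ne_zero hf), WithZero.exp_zero]

theorem ord_eq_zero_of_val_eq_one (h : P.val f = 1) : P.ord f = 0 := by
  rw [ord, h, WithZero.log_one, neg_zero]

theorem val_eq_exp_neg_ord (hf : f ≠ 0) : P.val f = WithZero.exp (-P.ord f) := by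
  rw [ord, neg_neg, WithZero.exp_log (val_ne_zero hf)]

theorem ord_eq_of_val_eq {n : ℤ} (h : P.val f = WithZero.exp (-n)) : P.ord f = n := by
  rw [ord, h, WithZero.log_exp, neg_neg]

theorem ord_add_of_lt (hf : f ≠ 0) (hg : g ≠ 0) (h : P.ord f < P.ord g) :
    P.ord (f + g) = P.ord f := by
  have h' : P.val g < P.val f := by
    rw [val_eq_exp_neg_ord hf, val_eq_exp_neg_ord hg, WithZero.exp_lt_exp]
    omega
  rw [ord, P.val.map_add_eq_of_lt_left h', ord]

variable (P) in
/-- The function `f` takes the value `c` at `P`. -/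
def HasValue (f : FunctionField) (c : ℂ) : Prop :=
  P.val (f - algebraMap ℂ FunctionField c) < 1

theorem hasValue_const (c : ℂ) : P.HasValue (algebraMap ℂ FunctionField c) c := by
  simp [HasValue]

theorem hasValue_one : P.HasValue 1 1 := by simpa using hasValue_const (P := P) 1

theorem hasValue_zero_of_ord_pos (h : 0 < P.ord f) : P.HasValue f 0 := by
  simpa [HasValue] using val_lt_one_of_ord_pos h

theorem HasValue.val_le {c : ℂ} (h : P.HasValue f c) : P.val f ≤ 1 := by
  have := P.val.map_add_le h.le (P.isPlace.const_le c)
  rwa [sub_add_cancel] at this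

theorem HasValue.val_eq_one {c : ℂ} (h : P.HasValue f c) (hc : c ≠ 0) : P.val f = 1 := by
  have h1 := P.trivial_on_const c hc
  have := P.val.map_add_eq_of_lt_right
    (show P.val (f - algebraMap ℂ FunctionField c) < P.val (algebraMap ℂ FunctionField c) by
      rw [h1]; exact h)
  rwa [sub_add_cancel, h1] at this

theorem HasValue.ord_eq_zero {c : ℂ} (h : P.HasValue f c) (hc : c ≠ 0) : P.ord f = 0 :=
  ord_eq_zero_of_val_eq_one (h.val_eq_one hc)

theorem HasValue.ne_zero {c : ℂ} (h : P.HasValue f c) (hc : c ≠ 0) : f ≠ 0 := by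
  rintro rfl
  simpa using h.val_eq_one hc

theorem HasValue.add {c d : ℂ} (h : P.HasValue f c) (h' : P.HasValue g d) :
    P.HasValue (f + g) (c + d) := by
  have := P.val.map_add_lt h h'
  rw [HasValue, map_add]
  convert this using 2
  ring

theorem HasValue.mul {c d : ℂ} (h : P.HasValue f c) (h' : P.HasValue g d) :
    P.HasValue (f * g) (c * d) := by
  have e : f * g - algebraMap ℂ FunctionField (c * d) =
      (f - algebraMap ℂ FunctionField c) * g +
        algebraMap ℂ FunctionField c * (g - algebraMap ℂ FunctionField d) := by
    rw [map_mul]; ring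
  rw [HasValue, e]
  refine P.val.map_add_lt ?_ ?_ <;> rw [map_mul]
  · exact mul_lt_one_of_lt_of_le h h'.val_le
  · rw [mul_comm]; exact mul_lt_one_of_lt_of_le h' (P.isPlace.const_le c)

theorem HasValue.neg {c : ℂ} (h : P.HasValue f c) : P.HasValue (-f) (-c) := by
  simpa using (hasValue_const (-1)).mul h

theorem HasValue.sub {c d : ℂ} (h : P.HasValue f c) (h' : P.HasValue g d) :
    P.HasValue (f - g) (c - d) := by
  simpa [sub_eq_add_neg] using h.add h'.neg

theorem HasValue.pow {c : ℂ} (h : P.HasValue f c) (n : ℕ) : P.HasValue (f ^ n) (c ^ n) := by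
  induction n with
  | zero => simpa using hasValue_one
  | succ n ih => simpa [pow_succ] using ih.mul h

theorem HasValue.inv {c : ℂ} (h : P.HasValue f c) (hc : c ≠ 0) : P.HasValue f⁻¹ c⁻¹ := by
  have hf := h.ne_zero hc
  have hc' : algebraMap ℂ FunctionField c ≠ 0 := by simpa using hc
  have e : f⁻¹ - algebraMap ℂ FunctionField c⁻¹ =
      -(f - algebraMap ℂ FunctionField c) * (f⁻¹ * (algebraMap ℂ FunctionField c)⁻¹) := by
    rw [map_inv₀]; field_simp; ring
  rw [HasValue, e, map_mul, map_mul, map_inv₀, map_inv₀, h.val_eq_one hc,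
    P.trivial_on_const c hc, Valuation.map_neg, inv_one, mul_one, mul_one]
  exact h

theorem HasValue.div {c d : ℂ} (h : P.HasValue f c) (h' : P.HasValue g d) (hd : d ≠ 0) :
    P.HasValue (f / g) (c / d) := by
  rw [div_eq_mul_inv, div_eq_mul_inv]
  exact h.mul (h'.inv hd)

theorem hasLeadingTerm_iff {t : FunctionField} {z : ℂ} {n : ℤ} :
    P.HasLeadingTerm t g z n ↔ P.HasValue (g / (algebraMap ℂ FunctionField z * t ^ n)) 1 := by
  rw [HasLeadingTerm, HasValue, map_one]

theorem HasLeadingTerm.ord_eq {t : FunctionField} {z : ℂ} {n : ℤ} (hz : z ≠ 0)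
    (ht : P.ord t = 1) (h : P.HasLeadingTerm t g z n) : P.ord g = n := by
  rw [hasLeadingTerm_iff] at h
  have h1 := h.ord_eq_zero one_ne_zero
  have h2 := h.ne_zero one_ne_zero
  have hg : g ≠ 0 := by rintro rfl; simp at h2
  have hzz : algebraMap ℂ FunctionField z ≠ 0 := by simpa using hz
  have ht0 : t ^ n ≠ 0 := by
    intro h0; rw [h0] at h2; simp at h2
  rw [ord_div hg (mul_ne_zero hzz ht0), ord_mul hzz ht0,
    ord_eq_zero_of_val_eq_one (P.trivial_on_const z hz), ord_zpow, ht] at h1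
  linarith

end Point

/-! ### Classification of the points by the value of `cyc` -/

/-- The orders of `u`, `w`, `1 + u² w` and `1 - u² w` at `P`. -/
structure HasOrds (P : Point) (a b p m : ℤ) : Prop where
  U : P.ord rulU = a
  W : P.ord rulW = b
  plus : P.ord (1 + cyc) = p
  minus : P.ord (1 - cyc) = m

theorem HasOrds.ord_cyc {P : Point} {a b p m : ℤ} (h : HasOrds P a b p m) : P.ord cyc = 2 * a + b := by
  rw [cyc_eq, Point.ord_mul (pow_ne_zero 2 rulU_ne_zero) rulW_ne_zero, Point.ord_pow, h.U, h.W]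
  norm_num

open Point

theorem ord_cyc_eq (P : Point) : P.ord cyc = 2 * P.ord rulU + P.ord rulW :=
  HasOrds.ord_cyc ⟨rfl, rfl, rfl, rfl⟩

theorem ord_kummer (P : Point) :
    5 * P.ord rulU + P.ord (1 - cyc) = 2 * P.ord cyc + P.ord (1 + cyc) := by
  have h := congrArg P.ord cyc_rel
  rw [ord_mul (pow_ne_zero 5 rulU_ne_zero) one_sub_cyc_ne_zero,
    ord_mul (pow_ne_zero 2 cyc_ne_zero) one_add_cyc_ne_zero, ord_pow, ord_pow] at h
  exact_mod_cast h

theorem ord_param_eq_one {P : Point} {t w : FunctionField} (hc : IsChart t w)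
    (ht : 0 < P.ord t) (hw : 0 < P.ord w) : P.ord t = 1 := by
  have ht0 : t ≠ 0 := by rintro rfl; simp [ord] at ht
  exact ord_eq_of_val_eq (hc.val_param P.isPlace ht0 (val_lt_one_of_ord_pos ht)
    (val_lt_one_of_ord_pos hw))

theorem ord_one {P : Point} : P.ord 1 = 0 := by simp [ord]

theorem chartB : IsChart rulW rulU := isChart_zero_zero adjoin_rul rul_rel
theorem chartA : IsChart rulW⁻¹ rulU⁻¹ :=
  isChart_inf_inf adjoin_rul rulU_ne_zero rulW_ne_zero rul_rel
theorem chartC : IsChart rulU rulW⁻¹ := isChart_zero_inf adjoin_rul rulW_ne_zero rul_rel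
theorem chartD : IsChart rulU⁻¹ rulW := isChart_inf_zero adjoin_rul rulU_ne_zero rul_rel

/-- At a branch value, `ord_kummer` and `ord_cyc_eq` fix the ratio of the orders of `U` and `W` and
their signs. The corner chart then applies and normalises one of them to `±1`. The next three cases
follow the same pattern. -/
theorem hasOrds_of_cyc_pos {P : Point} (h : 0 < P.ord cyc) : HasOrds P 2 1 0 0 := by
  have h0 := hasValue_zero_of_ord_pos h
  have hp : P.ord (1 + cyc) = 0 := (hasValue_one.add h0).ord_eq_zero (by norm_num)
  have hm : P.ord (1 - cyc) = 0 := (hasValue_one.sub h0).ord_eq_zero (by norm_num)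
  have h1 := ord_kummer P
  have h2 := ord_cyc_eq P
  have h3 := ord_param_eq_one (P := P) chartB (by omega) (by omega)
  exact ⟨by omega, h3, hp, hm⟩

theorem hasOrds_of_cyc_neg {P : Point} (h : P.ord cyc < 0) : HasOrds P (-2) (-1) (-5) (-5) := by
  have hp : P.ord (1 + cyc) = P.ord cyc := by
    rw [add_comm]
    exact ord_add_of_lt cyc_ne_zero one_ne_zero (by rwa [ord_one])
  have hm : P.ord (1 - cyc) = P.ord cyc := by
    have : P.ord (1 - cyc) = P.ord (cyc + -1) := by
      rw [← ord_neg]; congr 1; ring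
    rw [this]
    refine ord_add_of_lt cyc_ne_zero (by norm_num) ?_
    rwa [ord_neg, ord_one]
  have h1 := ord_kummer P
  have h2 := ord_cyc_eq P
  have h3 := ord_param_eq_one (P := P) chartA (by rw [ord_inv]; omega) (by rw [ord_inv]; omega)
  rw [ord_inv] at h3
  exact ⟨by omega, by omega, by omega, by omega⟩

theorem hasOrds_of_plus_pos {P : Point} (h : 0 < P.ord (1 + cyc)) : HasOrds P 1 (-2) 5 0 := by
  have h0 := hasValue_zero_of_ord_pos h
  have hs : P.HasValue cyc (-1) := by simpa using h0.sub hasValue_one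
  have hs0 : P.ord cyc = 0 := hs.ord_eq_zero (by norm_num)
  have hm : P.ord (1 - cyc) = 0 := (hasValue_one.sub hs).ord_eq_zero (by norm_num)
  have h1 := ord_kummer P
  have h2 := ord_cyc_eq P
  have h3 := ord_param_eq_one (P := P) chartC (by omega) (by rw [ord_inv]; omega)
  exact ⟨h3, by omega, by omega, hm⟩

theorem hasOrds_of_minus_pos {P : Point} (h : 0 < P.ord (1 - cyc)) : HasOrds P (-1) 2 0 5 := by
  have h0 := hasValue_zero_of_ord_pos h
  have hs : P.HasValue cyc 1 := by simpa using hasValue_one.sub h0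
  have hs0 : P.ord cyc = 0 := hs.ord_eq_zero (by norm_num)
  have hp : P.ord (1 + cyc) = 0 := (hasValue_one.add hs).ord_eq_zero (by norm_num)
  have h1 := ord_kummer P
  have h2 := ord_cyc_eq P
  have h3 := ord_param_eq_one (P := P) chartD (by rw [ord_inv]; omega) (by omega)
  rw [ord_inv] at h3
  exact ⟨by omega, by omega, by omega, by omega⟩

/-- The general point: `u² w - c` is a local parameter. -/
theorem hasOrds_of_generic {P : Point} (h : P.ord cyc = 0) (hp : ¬ 0 < P.ord (1 + cyc))
    (hm : ¬ 0 < P.ord (1 - cyc)) : HasOrds P 0 0 0 0 ∧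
      ∃ c u : ℂ, IsChart (cyc - algebraMap ℂ FunctionField c)
        (rulU - algebraMap ℂ FunctionField u) ∧ P.HasValue cyc c ∧ P.HasValue rulU u := by
  have h1 : P.val cyc ≤ 1 := (ord_nonneg_iff cyc_ne_zero).1 h.ge
  obtain ⟨c, hc⟩ : ∃ c, P.HasValue cyc c := P.isPlace.exists_const
    (isIntegral_kummer rul_rel (IntermediateField.mem_adjoin_simple_self ℂ cyc)
      one_sub_cyc_ne_zero) (adjoin_kummer adjoin_rul rulU_ne_zero) h1
  have c0 : c ≠ 0 := by
    rintro rfl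
    have : P.val cyc < 1 := by simpa [HasValue] using hc
    have := (ord_pos_iff cyc_ne_zero).2 this
    omega
  have cp : 1 + c ≠ 0 := by
    intro hz
    have := hasValue_one.add hc
    rw [hz] at this
    exact hp ((ord_pos_iff one_add_cyc_ne_zero).2 (by simpa [HasValue] using this))
  have cm : 1 - c ≠ 0 := by
    intro hz
    have := hasValue_one.sub hc
    rw [hz] at this
    exact hm ((ord_pos_iff one_sub_cyc_ne_zero).2 (by simpa [HasValue] using this))
  have op := (hasValue_one.add hc).ord_eq_zero cp
  have om := (hasValue_one.sub hc).ord_eq_zero cm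
  have h2 := ord_kummer P
  have h3 := ord_cyc_eq P
  have hU : P.ord rulU = 0 := by omega
  have hU5 : rulU ^ 5 = cyc ^ 2 * (1 + cyc) / (1 - cyc) := by
    rw [← cyc_rel, mul_div_cancel_right₀ _ one_sub_cyc_ne_zero]
  have v5 : P.HasValue (rulU ^ 5) (c ^ 2 * (1 + c) / (1 - c)) := by
    rw [hU5]
    exact ((hc.pow 2).mul (hasValue_one.add hc)).div (hasValue_one.sub hc) cm
  obtain ⟨u, hu⟩ : ∃ u, P.HasValue rulU u := by
    refine P.isPlace.exists_const_of_aeval ((ord_nonneg_iff rulU_ne_zero).1 hU.ge)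
      (p := X ^ 5 - C (c ^ 2 * (1 + c) / (1 - c))) (X_pow_sub_C_ne_zero (by norm_num) _) ?_
    simpa [HasValue] using v5
  have u0 : u ≠ 0 := by
    rintro rfl
    have : P.val rulU < 1 := by simpa [HasValue] using hu
    have := (ord_pos_iff rulU_ne_zero).2 this
    omega
  refine ⟨⟨hU, by omega, op, om⟩, c, u, ?_, hc, hu⟩
  refine isChart_kummer adjoin_rul rulU_ne_zero rul_rel u0 cm ?_
  -- The Kummer relation passes to values, since the zero function has no nonzero value.
  have hz : P.HasValue 0 (u ^ 5 * (1 - c) - c ^ 2 * (1 + c)) := by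
    have := ((hu.pow 5).mul (hasValue_one.sub hc)).sub ((hc.pow 2).mul (hasValue_one.add hc))
    rwa [cyc_rel, sub_self] at this
  by_contra hne
  exact hz.ne_zero (sub_ne_zero.2 hne) rfl

theorem hasOrds_cases (P : Point) : HasOrds P (-2) (-1) (-5) (-5) ∨ HasOrds P 2 1 0 0 ∨
    HasOrds P 1 (-2) 5 0 ∨ HasOrds P (-1) 2 0 5 ∨ (HasOrds P 0 0 0 0 ∧
      ∃ c u : ℂ, IsChart (cyc - algebraMap ℂ FunctionField c)
        (rulU - algebraMap ℂ FunctionField u) ∧ P.HasValue cyc c ∧ P.HasValue rulU u) := by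
  rcases lt_trichotomy (P.ord cyc) 0 with h | h | h
  · exact Or.inl (hasOrds_of_cyc_neg h)
  · by_cases hp : 0 < P.ord (1 + cyc)
    · exact Or.inr (Or.inr (Or.inl (hasOrds_of_plus_pos hp)))
    by_cases hm : 0 < P.ord (1 - cyc)
    · exact Or.inr (Or.inr (Or.inr (Or.inl (hasOrds_of_minus_pos hm))))
    exact Or.inr (Or.inr (Or.inr (Or.inr (hasOrds_of_generic h hp hm))))
  · exact Or.inr (Or.inl (hasOrds_of_cyc_pos h))

theorem Point.ext_val {P Q : Point} (h : P.val = Q.val) : P = Q := by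
  cases P; cases Q; simp only at h; subst h; rfl

theorem eq_of_chart {P Q : Point} {t w : FunctionField} (hc : IsChart t w)
    (ht : 0 < P.ord t) (hw : 0 < P.ord w) (ht' : 0 < Q.ord t) (hw' : 0 < Q.ord w) : P = Q := by
  have ht0 : t ≠ 0 := by rintro rfl; simp [ord] at ht
  exact Point.ext_val (hc.val_unique P.isPlace Q.isPlace ht0 (val_lt_one_of_ord_pos ht)
    (val_lt_one_of_ord_pos hw) (val_lt_one_of_ord_pos ht') (val_lt_one_of_ord_pos hw'))

/-- Since `s` lies in `ℂ(g)`, the function `g` is transcendental and `U` is integral over `ℂ(g)`.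
The uses are `g = s⁻¹, s, 1 + s, 1 - s`, one for each branch value. -/
theorem exists_point {g : FunctionField} (hg : cyc ∈ IntermediateField.adjoin ℂ {g}) :
    ∃ P : Point, P.val g < 1 := by
  have htr : Transcendental ℂ g := by
    intro h
    have : Algebra.IsAlgebraic ℂ (IntermediateField.adjoin ℂ {g}) :=
      IntermediateField.isAlgebraic_adjoin_simple h.isIntegral
    exact transcendental_cyc ((Algebra.IsAlgebraic.isAlgebraic (R := ℂ)
      (⟨cyc, hg⟩ : IntermediateField.adjoin ℂ {g})).algHom
        (IntermediateField.adjoin ℂ {g}).val)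
  have htop : IntermediateField.adjoin ℂ {g, rulU} = ⊤ := by
    refine adjoin_eq_top_of_mem (adjoin_kummer adjoin_rul rulU_ne_zero) ?_ (mem_field_right _ _)
    exact IntermediateField.adjoin.mono ℂ {g} {g, rulU} (by simp) hg
  obtain ⟨v, hv, h⟩ := exists_isPlace_val_lt_one htr
    (isIntegral_kummer rul_rel hg one_sub_cyc_ne_zero) htop
  exact ⟨⟨v, hv.surjective, hv.map_const⟩, h⟩

theorem exists_pointA : ∃ P, HasOrds P (-2) (-1) (-5) (-5) := by
  obtain ⟨P, hP⟩ := exists_point (g := cyc⁻¹)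
    (by simpa using inv_mem (IntermediateField.mem_adjoin_simple_self ℂ cyc⁻¹))
  have := (ord_pos_iff (inv_ne_zero cyc_ne_zero)).2 hP
  rw [ord_inv] at this
  exact ⟨P, hasOrds_of_cyc_neg (by omega)⟩

theorem exists_pointB : ∃ P, HasOrds P 2 1 0 0 := by
  obtain ⟨P, hP⟩ := exists_point (g := cyc) (IntermediateField.mem_adjoin_simple_self ℂ cyc)
  exact ⟨P, hasOrds_of_cyc_pos ((ord_pos_iff cyc_ne_zero).2 hP)⟩

theorem exists_pointC : ∃ P, HasOrds P 1 (-2) 5 0 := by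
  obtain ⟨P, hP⟩ := exists_point (g := 1 + cyc)
    (by simpa using sub_mem (IntermediateField.mem_adjoin_simple_self ℂ (1 + cyc)) (one_mem _))
  exact ⟨P, hasOrds_of_plus_pos ((ord_pos_iff one_add_cyc_ne_zero).2 hP)⟩

theorem exists_pointD : ∃ P, HasOrds P (-1) 2 0 5 := by
  obtain ⟨P, hP⟩ := exists_point (g := 1 - cyc)
    (by simpa using sub_mem (one_mem _) (IntermediateField.mem_adjoin_simple_self ℂ (1 - cyc)))
  exact ⟨P, hasOrds_of_minus_pos ((ord_pos_iff one_sub_cyc_ne_zero).2 hP)⟩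

end BringCurve

namespace BringCurve

/-! ### Matching the four branch points with the local expansions -/

open Point

section Coordinates

variable {P : Point} {a b p m : ℤ}

theorem ord_y (h : HasOrds P a b p m) : P.ord y = b - a := by
  rw [y_eq, ord_div rulW_ne_zero rulU_ne_zero, h.U, h.W]

theorem HasOrds.ord_monomial (h : HasOrds P a b p m) (i j : ℤ) :
    P.ord (rulU ^ i * rulW ^ j) = i * a + j * b := by
  rw [ord_mul (zpow_ne_zero i rulU_ne_zero) (zpow_ne_zero j rulW_ne_zero), ord_zpow, ord_zpow,
    h.U, h.W]

theorem HasOrds.hasValue_monomial (h : HasOrds P a b p m) (i j : ℤ) (hp : 0 < i * a + j * b) :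
    P.HasValue (rulU ^ i * rulW ^ j) 0 :=
  hasValue_zero_of_ord_pos (by rwa [h.ord_monomial])

/-- Supplies the leading coefficient relating `W²` to `U`: the ratio is `1` where `s = 0` and `-1`
where `s = ∞`. -/
theorem rulW_sq_div : rulW ^ 2 / rulU = (1 - cyc) / (1 + cyc) := by
  rw [div_eq_div_iff rulU_ne_zero one_add_cyc_ne_zero, cyc_eq]
  linear_combination -rul_rel

/-- Here `x y² = (1 + (W² / U)²) / (1 + U³ / W)`, whose value is `(1 + 1) / 1`; this is the
coefficient `2` in the expansion. -/
theorem HasOrds.value_B (h : HasOrds P 2 1 0 0) : P.HasValue (x * y ^ 2) 2 := by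
  have h0 : P.HasValue cyc 0 := hasValue_zero_of_ord_pos (by rw [h.ord_cyc]; norm_num)
  have hr : P.HasValue (rulW ^ 2 / rulU) 1 := by
    rw [rulW_sq_div]
    simpa using (hasValue_one.sub h0).div (hasValue_one.add h0) (by norm_num)
  have h1 := h.hasValue_monomial 3 (-1) (by norm_num)
  have key := (hasValue_one.add (hr.pow 2)).div (hasValue_one.add h1) (by norm_num)
  convert key using 1
  · have := x_denom_ne_zero
    have hU := rulU_ne_zero
    have hW := rulW_ne_zero
    have hd : rulW + rulU ^ 3 ≠ 0 := by
      intro hz; apply this; linear_combination rulW * hz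
    have hd' : 1 + rulU ^ (3 : ℤ) * rulW ^ (-1 : ℤ) ≠ 0 :=
      (hasValue_one.add h1).ne_zero (by norm_num)
    rw [x_eq, y_eq, div_mul_eq_mul_div, div_eq_div_iff this hd', zpow_neg, zpow_one]
    norm_cast
    field_simp
  · norm_num

theorem HasOrds.value_A (h : HasOrds P (-2) (-1) (-5) (-5)) : P.HasValue (x / y ^ 3) 2 := by
  have h0 : P.HasValue cyc⁻¹ 0 := hasValue_zero_of_ord_pos (by rw [ord_inv, h.ord_cyc]; norm_num)
  have hr : P.HasValue (rulW ^ 2 / rulU) (-1) := by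
    have e : (1 - cyc) / (1 + cyc) = (cyc⁻¹ - 1) / (cyc⁻¹ + 1) := by
      have h1 := cyc_ne_zero
      have h2 := one_add_cyc_ne_zero
      have h3 : cyc⁻¹ + 1 ≠ 0 := (h0.add hasValue_one).ne_zero (by norm_num)
      rw [div_eq_div_iff h2 h3]
      field_simp
    rw [rulW_sq_div, e]
    simpa using (h0.sub hasValue_one).div (h0.add hasValue_one) (by norm_num)
  have h1 := h.hasValue_monomial (-3) 1 (by norm_num)
  have key := (hasValue_one.add ((hr.inv (by norm_num)).pow 2)).div
    (hasValue_one.add h1) (by norm_num)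
  convert key using 1
  · have := x_denom_ne_zero
    have hU := rulU_ne_zero
    have hW := rulW_ne_zero
    have hd' : 1 + rulU ^ (-3 : ℤ) * rulW ^ (1 : ℤ) ≠ 0 :=
      (hasValue_one.add h1).ne_zero (by norm_num)
    rw [x_eq, y_eq, div_div, div_eq_div_iff (mul_ne_zero this (by positivity)) hd', zpow_neg,
      zpow_one]
    norm_cast
    field_simp
    ring
  · norm_num

/-- One has `x = W² e` with `e` of value `1`, so `y⁴ / x³ = (s² e³)⁻¹`, and `s` has value `-1`. -/
theorem HasOrds.value_C (h : HasOrds P 1 (-2) 5 0) :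
    P.HasValue (y ^ 4 / x ^ 3) 1 ∧ P.ord x = -4 := by
  have hs : P.HasValue cyc (-1) := by
    have := (hasValue_zero_of_ord_pos (show 0 < P.ord (1 + cyc) by rw [h.plus]; norm_num)).sub
      hasValue_one
    simpa using this
  have h1 := h.hasValue_monomial 2 (-4) (by norm_num)
  have h2 := h.hasValue_monomial 3 (-1) (by norm_num)
  have key := (hasValue_one.add h1).div (hasValue_one.add h2) (by norm_num)
  set e := (1 + rulU ^ (2 : ℤ) * rulW ^ (-4 : ℤ)) / (1 + rulU ^ (3 : ℤ) * rulW ^ (-1 : ℤ))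
    with he
  have ke : P.HasValue e 1 := by simpa using key
  have e0 := ke.ne_zero one_ne_zero
  have hU := rulU_ne_zero
  have hW := rulW_ne_zero
  have hx : x = rulW ^ 2 * e := by
    have := x_denom_ne_zero
    have hd' : 1 + rulU ^ (3 : ℤ) * rulW ^ (-1 : ℤ) ≠ 0 :=
      (hasValue_one.add h2).ne_zero (by norm_num)
    rw [x_eq, he, mul_div_assoc', div_eq_div_iff this hd', zpow_neg, zpow_neg, zpow_one]
    norm_cast
    field_simp
    ring
  constructor
  · have hy : y ^ 4 / x ^ 3 = (cyc ^ 2 * e ^ 3)⁻¹ := by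
      rw [hx, y_eq, cyc_eq]
      field_simp
    rw [hy]
    simpa using ((hs.pow 2).mul (ke.pow 3)).inv (by norm_num)
  · rw [hx, ord_mul (pow_ne_zero 2 hW) e0, ord_pow, h.W, ke.ord_eq_zero one_ne_zero]
    norm_num

theorem HasOrds.value_D (h : HasOrds P (-1) 2 0 5) :
    P.HasValue (y * x ^ 3) 1 ∧ P.ord x = -1 := by
  have hs : P.HasValue cyc 1 := by
    have := hasValue_one.sub
      (hasValue_zero_of_ord_pos (show 0 < P.ord (1 - cyc) by rw [h.minus]; norm_num))
    simpa using this
  have h1 := h.hasValue_monomial (-2) 4 (by norm_num)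
  have h2 := h.hasValue_monomial (-3) 1 (by norm_num)
  have key := (hasValue_one.add h1).div (hasValue_one.add h2) (by norm_num)
  set e := (1 + rulU ^ (-2 : ℤ) * rulW ^ (4 : ℤ)) / (1 + rulU ^ (-3 : ℤ) * rulW ^ (1 : ℤ))
    with he
  have ke : P.HasValue e 1 := by simpa using key
  have e0 := ke.ne_zero one_ne_zero
  have hU := rulU_ne_zero
  have hW := rulW_ne_zero
  have hx : x = (rulU * rulW)⁻¹ * e := by
    have := x_denom_ne_zero
    have hd' : 1 + rulU ^ (-3 : ℤ) * rulW ^ (1 : ℤ) ≠ 0 :=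
      (hasValue_one.add h2).ne_zero (by norm_num)
    rw [x_eq, he, mul_div_assoc', div_eq_div_iff this hd', zpow_neg, zpow_neg, zpow_one]
    norm_cast
    field_simp
    ring
  constructor
  · have hy : y * x ^ 3 = e ^ 3 / cyc ^ 2 := by
      rw [hx, y_eq, cyc_eq]
      field_simp
    rw [hy]
    simpa using (ke.pow 3).div (hs.pow 2) (by norm_num)
  · rw [hx, ord_mul (inv_ne_zero (mul_ne_zero hU hW)) e0, ord_inv, ord_mul hU hW, h.U, h.W,
      ke.ord_eq_zero one_ne_zero]
    norm_num

theorem HasOrds.isPointA (h : HasOrds P (-2) (-1) (-5) (-5)) : IsPointA P := by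
  have hy := y_ne_zero
  refine ⟨y, by rw [ord_y h]; norm_num, hasLeadingTerm_iff.2 ?_, hasLeadingTerm_iff.2 ?_⟩
  · have := h.value_A.div (hasValue_const 2) (by norm_num)
    rw [div_self (by norm_num)] at this
    convert this using 1
    norm_cast
    rw [div_div, mul_comm]
  · have e : y / (algebraMap ℂ FunctionField 1 * y ^ (1 : ℤ)) = 1 := by
      rw [map_one, one_mul, zpow_one, div_self hy]
    rw [e]
    exact hasValue_one

theorem HasOrds.isPointB (h : HasOrds P 2 1 0 0) : IsPointB P := by
  have hy := y_ne_zero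
  refine ⟨y⁻¹, by rw [ord_inv, ord_y h]; norm_num, hasLeadingTerm_iff.2 ?_,
    hasLeadingTerm_iff.2 ?_⟩
  · have := h.value_B.div (hasValue_const 2) (by norm_num)
    rw [div_self (by norm_num)] at this
    convert this using 1
    norm_cast
    field_simp
  · have e : y / (algebraMap ℂ FunctionField 1 * y⁻¹ ^ (-1 : ℤ)) = 1 := by
      rw [map_one, one_mul, zpow_neg, zpow_one, inv_inv, div_self hy]
    rw [e]
    exact hasValue_one

theorem HasOrds.isPointC (h : HasOrds P 1 (-2) 5 0) : IsPointC P := by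
  have hy := y_ne_zero
  obtain ⟨h1, h2⟩ := h.value_C
  have hx : x ≠ 0 := by intro h0; simp [h0, ord] at h2
  -- The parameter is `Y / X = y / x`; with it `x t⁴` and `y t³` both equal `y⁴ / x³`.
  refine ⟨y / x, by rw [ord_div hy hx, ord_y h, h2]; norm_num, hasLeadingTerm_iff.2 ?_,
    hasLeadingTerm_iff.2 ?_⟩
  · convert h1 using 1
    rw [map_one, one_mul, zpow_neg]
    norm_cast
    field_simp
  · convert h1 using 1
    rw [map_one, one_mul, zpow_neg]
    norm_cast
    field_simp

theorem HasOrds.isPointD (h : HasOrds P (-1) 2 0 5) : IsPointD P := by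
  obtain ⟨h1, h2⟩ := h.value_D
  have hx : x ≠ 0 := by intro h0; simp [h0, ord] at h2
  refine ⟨x⁻¹, by rw [ord_inv, h2]; norm_num, hasLeadingTerm_iff.2 ?_,
    hasLeadingTerm_iff.2 ?_⟩
  · have e : x / (algebraMap ℂ FunctionField 1 * x⁻¹ ^ (-1 : ℤ)) = 1 := by
      rw [map_one, one_mul, zpow_neg, zpow_one, inv_inv, div_self hx]
    rw [e]
    exact hasValue_one
  · convert h1 using 1
    rw [map_one, one_mul]
    norm_cast
    field_simp

/-- The order of `y` is `1, -1, -3, 3, 0` in the five cases, so it alone identifies the point. -/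
theorem IsPointA.hasOrds (h : IsPointA P) : HasOrds P (-2) (-1) (-5) (-5) := by
  obtain ⟨t, ht, -, hy⟩ := h
  have h1 := hy.ord_eq one_ne_zero ht
  rcases hasOrds_cases P with h | h | h | h | ⟨h, -⟩
  · exact h
  all_goals rw [ord_y h] at h1; norm_num at h1

theorem IsPointB.hasOrds (h : IsPointB P) : HasOrds P 2 1 0 0 := by
  obtain ⟨t, ht, -, hy⟩ := h
  have h1 := hy.ord_eq one_ne_zero ht
  rcases hasOrds_cases P with h | h | h | h | ⟨h, -⟩
  · rw [ord_y h] at h1; norm_num at h1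
  · exact h
  all_goals rw [ord_y h] at h1; norm_num at h1

theorem IsPointC.hasOrds (h : IsPointC P) : HasOrds P 1 (-2) 5 0 := by
  obtain ⟨t, ht, -, hy⟩ := h
  have h1 := hy.ord_eq one_ne_zero ht
  rcases hasOrds_cases P with h | h | h | h | ⟨h, -⟩
  on_goal 3 => exact h
  all_goals rw [ord_y h] at h1; norm_num at h1

theorem IsPointD.hasOrds (h : IsPointD P) : HasOrds P (-1) 2 0 5 := by
  obtain ⟨t, ht, -, hy⟩ := h
  have h1 := hy.ord_eq one_ne_zero ht
  rcases hasOrds_cases P with h | h | h | h | ⟨h, -⟩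
  on_goal 4 => exact h
  all_goals rw [ord_y h] at h1; norm_num at h1

variable {Q : Point}

theorem HasOrds.eqA (h : HasOrds P (-2) (-1) (-5) (-5)) (h' : HasOrds Q (-2) (-1) (-5) (-5)) :
    P = Q :=
  eq_of_chart chartA (by simp [ord_inv, h.W]) (by simp [ord_inv, h.U])
    (by simp [ord_inv, h'.W]) (by simp [ord_inv, h'.U])

theorem HasOrds.eqB (h : HasOrds P 2 1 0 0) (h' : HasOrds Q 2 1 0 0) : P = Q :=
  eq_of_chart chartB (by simp [h.W]) (by simp [h.U]) (by simp [h'.W]) (by simp [h'.U])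

theorem HasOrds.eqC (h : HasOrds P 1 (-2) 5 0) (h' : HasOrds Q 1 (-2) 5 0) : P = Q :=
  eq_of_chart chartC (by simp [h.U]) (by simp [ord_inv, h.W]) (by simp [h'.U])
    (by simp [ord_inv, h'.W])

theorem HasOrds.eqD (h : HasOrds P (-1) 2 0 5) (h' : HasOrds Q (-1) 2 0 5) : P = Q :=
  eq_of_chart chartD (by simp [ord_inv, h.U]) (by simp [h.W]) (by simp [ord_inv, h'.U])
    (by simp [h'.W])

end Coordinates

end BringCurve

namespace BringCurve

/-! ### Differentials and the ruling functions -/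

open Point KaehlerDifferential

/-- The differential structure at a point: every differential `dh` is a multiple of `dt` for a
local parameter `t`, with the expected order. -/
structure IsLocalDifferential (P : Point) (t : FunctionField) : Prop where
  ord_eq : P.ord t = 1
  ne_zero : D ℂ FunctionField t ≠ 0
  exists_eq : ∀ h : FunctionField, h ≠ 0 → ∃ g : FunctionField,
    D ℂ FunctionField h = g • D ℂ FunctionField t ∧
      (P.ord h ≠ 0 → g ≠ 0 ∧ P.ord g = P.ord h - 1)

theorem isLocalDifferential_of_chart {P : Point} {t w : FunctionField} (hc : IsChart t w)
    (ht0 : t ≠ 0) (ht : P.val t < 1) (hw : P.val w < 1) : IsLocalDifferential P t := by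
  have hex : ∀ h : FunctionField, h ≠ 0 → ∃ g : FunctionField,
      D ℂ FunctionField h = g • D ℂ FunctionField t ∧
        (P.ord h ≠ 0 → g ≠ 0 ∧ P.ord g = P.ord h - 1) := by
    intro h h0
    obtain ⟨g, hg, hg'⟩ := hc.exists_D_eq P.isPlace ht0 ht hw h0
    refine ⟨g, hg, fun hn => ?_⟩
    have e := hg' (by simpa [ord] using hn)
    rw [val_eq_exp_neg_ord h0, ← WithZero.exp_add] at e
    refine ⟨?_, ord_eq_of_val_eq (by rw [e]; congr 1; ring)⟩
    rintro rfl
    rw [map_zero] at e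
    exact WithZero.exp_ne_zero e.symm
  refine ⟨ord_eq_of_val_eq (hc.val_param P.isPlace ht0 ht hw), fun h0 => ?_, hex⟩
  obtain ⟨h, hh⟩ := nontrivial_kaehler
  have hne : h ≠ 0 := by rintro rfl; simp at hh
  obtain ⟨g, hg, -⟩ := hex h hne
  rw [hg, h0, smul_zero] at hh
  exact hh rfl

theorem isLocalDifferential_of_ord {P : Point} {t w : FunctionField} (hc : IsChart t w)
    (ht : 0 < P.ord t) (hw : 0 < P.ord w) : IsLocalDifferential P t :=
  isLocalDifferential_of_chart hc (by rintro rfl; simp [ord] at ht) (val_lt_one_of_ord_pos ht)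
    (val_lt_one_of_ord_pos hw)

theorem IsLocalDifferential.of_ord_ne_zero {P : Point} {t h : FunctionField}
    (ht : IsLocalDifferential P t) (hh : P.ord h ≠ 0) : ∃ g : FunctionField,
      D ℂ FunctionField h = g • D ℂ FunctionField t ∧ g ≠ 0 ∧ P.ord g = P.ord h - 1 := by
  obtain ⟨g, hg, hg'⟩ := ht.exists_eq h (by rintro rfl; simp [ord] at hh)
  exact ⟨g, hg, hg' hh⟩

/-- The differential `d(u² w)` in terms of a local parameter. -/
theorem exists_D_cyc (P : Point) : ∃ t g : FunctionField, IsLocalDifferential P t ∧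
    D ℂ FunctionField cyc = g • D ℂ FunctionField t ∧ g ≠ 0 ∧
    ((HasOrds P (-2) (-1) (-5) (-5) ∧ P.ord g = -6) ∨ (HasOrds P 2 1 0 0 ∧ P.ord g = 4) ∨
      (HasOrds P 1 (-2) 5 0 ∧ P.ord g = 4) ∨ (HasOrds P (-1) 2 0 5 ∧ P.ord g = 4) ∨
      (HasOrds P 0 0 0 0 ∧ P.ord g = 0)) := by
  rcases hasOrds_cases P with h | h | h | h | ⟨h, c, u, hc, h1, h2⟩
  · have hl := isLocalDifferential_of_ord (P := P) chartA (by simp [ord_inv, h.W])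
      (by simp [ord_inv, h.U])
    obtain ⟨g, hg, g0, og⟩ := hl.of_ord_ne_zero (h := cyc) (by rw [h.ord_cyc]; norm_num)
    exact ⟨_, g, hl, hg, g0, Or.inl ⟨h, by rw [og, h.ord_cyc]; norm_num⟩⟩
  · have hl := isLocalDifferential_of_ord (P := P) chartB (by simp [h.W]) (by simp [h.U])
    obtain ⟨g, hg, g0, og⟩ := hl.of_ord_ne_zero (h := cyc) (by rw [h.ord_cyc]; norm_num)
    exact ⟨_, g, hl, hg, g0, Or.inr (Or.inl ⟨h, by rw [og, h.ord_cyc]; norm_num⟩)⟩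
  · have hl := isLocalDifferential_of_ord (P := P) chartC (by simp [h.U]) (by simp [ord_inv, h.W])
    -- Here `s` has order zero, where the order of its differential is not determined; `1 + s` has
    -- the same differential and vanishes to order five.
    obtain ⟨g, hg, g0, og⟩ := hl.of_ord_ne_zero (h := 1 + cyc) (by rw [h.plus]; norm_num)
    refine ⟨_, g, hl, ?_, g0, Or.inr (Or.inr (Or.inl ⟨h, by rw [og, h.plus]; norm_num⟩))⟩
    rw [← hg, map_add, Derivation.map_one_eq_zero, zero_add]
  · have hl := isLocalDifferential_of_ord (P := P) chartD (by simp [ord_inv, h.U]) (by simp [h.W])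
    obtain ⟨g, hg, g0, og⟩ := hl.of_ord_ne_zero (h := 1 - cyc) (by rw [h.minus]; norm_num)
    refine ⟨_, -g, hl, ?_, neg_ne_zero.2 g0,
      Or.inr (Or.inr (Or.inr (Or.inl ⟨h, by rw [ord_neg, og, h.minus]; norm_num⟩)))⟩
    rw [neg_smul, ← hg, map_sub, Derivation.map_one_eq_zero, zero_sub, neg_neg]
  · have hl := isLocalDifferential_of_chart (P := P) hc (cyc_sub_const_ne_zero c) h1 h2
    refine ⟨_, 1, hl, ?_, one_ne_zero, Or.inr (Or.inr (Or.inr (Or.inr ⟨h, ord_one⟩)))⟩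
    rw [map_sub, Derivation.map_algebraMap, sub_zero, one_smul]

theorem D_cyc_ne_zero : D ℂ FunctionField cyc ≠ 0 := by
  obtain ⟨P, -⟩ := exists_pointA
  obtain ⟨t, g, hl, hg, g0, -⟩ := exists_D_cyc P
  rw [hg]
  exact smul_ne_zero g0 hl.ne_zero

/-- At one fixed point every `dh` is a multiple of `dt`, and `ds` is a nonzero multiple of it, so
`ds` spans all differentials. -/
theorem exists_eq_smul_D_cyc (ω : Ω[FunctionField⁄ℂ]) :
    ∃ h : FunctionField, ω = h • D ℂ FunctionField cyc := by
  obtain ⟨P, -⟩ := exists_pointA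
  obtain ⟨t, g, hl, hg, g0, -⟩ := exists_D_cyc P
  have ht : D ℂ FunctionField t = g⁻¹ • D ℂ FunctionField cyc := by
    rw [hg, smul_smul, inv_mul_cancel₀ g0, one_smul]
  have hω : ω ∈ Submodule.span FunctionField (Set.range (D ℂ FunctionField)) := by
    rw [span_range_derivation]; trivial
  have hle : Submodule.span FunctionField (Set.range (D ℂ FunctionField)) ≤
      Submodule.span FunctionField {D ℂ FunctionField cyc} := by
    rw [Submodule.span_le]
    rintro _ ⟨h, rfl⟩
    by_cases h0 : h = 0
    · simp [h0]
    obtain ⟨k, hk, -⟩ := hl.exists_eq h h0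
    rw [hk, ht, smul_smul]
    exact Submodule.smul_mem _ _ (Submodule.mem_span_singleton_self _)
  obtain ⟨h, hh⟩ := Submodule.mem_span_singleton.1 (hle hω)
  exact ⟨h, hh.symm⟩

/-- Two canonical divisors differ by the divisor of a function, compared locally. -/
theorem ord_differential_eq {P : Point} {t g t' g' h : FunctionField} (hl : IsLocalDifferential P t)
    (hg : D ℂ FunctionField cyc = g • D ℂ FunctionField t) (g0 : g ≠ 0) (ht' : P.ord t' = 1)
    (g0' : g' ≠ 0) (h0 : h ≠ 0)
    (hh : h • D ℂ FunctionField cyc = g' • D ℂ FunctionField t') :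
    P.ord g' = P.ord h + P.ord g := by
  obtain ⟨e, he, e0, oe⟩ := hl.of_ord_ne_zero (h := t') (by rw [ht']; norm_num)
  rw [hg, he, smul_smul, smul_smul] at hh
  have := smul_left_injective FunctionField hl.ne_zero hh
  have := congrArg P.ord this
  rw [ord_mul h0 g0, ord_mul g0' e0, oe, ht'] at this
  linarith

/-- At `a` the orders of `x` and `y` are `3` and `1`, so the term `-6 y²` dominates: `fy / y²` has
value `-6` there. -/
theorem fy_ne_zero : fy ≠ 0 := by
  obtain ⟨P, h⟩ := exists_pointA
  have hy := y_ne_zero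
  have oy : P.ord y = 1 := by rw [ord_y h]; norm_num
  have h2 := h.value_A
  have x0 : x ≠ 0 := by
    intro h0; have := h2.ne_zero two_ne_zero; rw [h0, zero_div] at this; exact this rfl
  have ox : P.ord x = 3 := by
    have := h2.ord_eq_zero two_ne_zero
    rw [ord_div x0 (pow_ne_zero 3 hy), ord_pow, oy] at this
    norm_num at this
    linarith
  have v1 : P.HasValue (x * y ^ 2) 0 := hasValue_zero_of_ord_pos (by
    rw [ord_mul x0 (pow_ne_zero 2 hy), ord_pow, ox, oy]; norm_num)
  have v2 : P.HasValue (x ^ 2 / y) 0 := hasValue_zero_of_ord_pos (by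
    rw [ord_div (pow_ne_zero 2 x0) hy, ord_pow, ox, oy]; norm_num)
  have v3 : P.HasValue (x ^ 4 / y ^ 2) 0 := hasValue_zero_of_ord_pos (by
    rw [ord_div (pow_ne_zero 4 x0) (pow_ne_zero 2 hy), ord_pow, ord_pow, ox, oy]; norm_num)
  have key := ((((hasValue_const 5).mul v1).add ((hasValue_const 2).mul v2)).sub v3).sub
    (hasValue_const 6)
  have hne := key.ne_zero (by norm_num)
  have e : fy = y ^ 2 * (algebraMap ℂ FunctionField 5 * (x * y ^ 2) +
      algebraMap ℂ FunctionField 2 * (x ^ 2 / y) - x ^ 4 / y ^ 2 -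
      algebraMap ℂ FunctionField 6) := by
    simp only [map_ofNat]
    rw [fy]
    field_simp
  rw [e]
  exact mul_ne_zero (pow_ne_zero 2 hy) hne

theorem D_x_ne_zero : D ℂ FunctionField x ≠ 0 := by
  obtain ⟨P, h⟩ := exists_pointD
  obtain ⟨t, g, hl, -⟩ := exists_D_cyc P
  obtain ⟨k, hk, k0, -⟩ := hl.of_ord_ne_zero (h := x) (by rw [h.value_D.2]; norm_num)
  rw [hk]
  exact smul_ne_zero k0 hl.ne_zero

theorem v_zero_ne_zero : v 0 ≠ 0 :=
  smul_ne_zero (div_ne_zero y_cube_sub_x_ne_zero fy_ne_zero) D_x_ne_zero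

theorem v_eq_smul (i : Fin 4) : v i = phi ![1, rulU] ![1, rulW] i • v 0 := by
  have hU := rulU_mul
  have h1 := vNum_one_rel curve_eq y_cube_sub_x_ne_zero rulU_mul (W := rulW) rfl
  have hW : rulW = y * rulU := rfl
  simp only [v, smul_smul]
  congr 1
  rw [mul_div_assoc']
  congr 1
  fin_cases i
  · simp [vNum, phi]
  · simpa [vNum, phi] using h1
  · simpa [vNum, phi] using hU.symm
  · simp only [vNum, phi]
    simp
    rw [hW]
    linear_combination y * hU

theorem areRulings_rul : AreRulings ![1, rulU] ![1, rulW] := ⟨v 0, v_zero_ne_zero, v_eq_smul⟩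

/-- Homogeneous coordinates are only defined up to scaling; comparing `v₃` and `v₄` with `v₁` shows
that the ratios do not depend on the choice. -/
theorem AreRulings.eq {s r : Fin 2 → FunctionField} (h : AreRulings s r) :
    s 0 ≠ 0 ∧ r 0 ≠ 0 ∧ s 1 / s 0 = rulU ∧ r 1 / r 0 = rulW := by
  obtain ⟨η, hη, hv⟩ := h
  have inj := smul_left_injective FunctionField hη
  have h0 : v 0 = (s 0 * r 0) • η := hv 0
  have hne : s 0 * r 0 ≠ 0 := by
    intro hz
    rw [hz, zero_smul] at h0
    exact v_zero_ne_zero h0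
  have hs := left_ne_zero_of_mul hne
  have hr := right_ne_zero_of_mul hne
  have h2 : v 2 = (s 1 * r 0) • η := hv 2
  have h3 : v 3 = (-(s 0 * r 1)) • η := hv 3
  have e2 : v 2 = (rulU * 1) • v 0 := v_eq_smul 2
  have e3 : v 3 = (-(1 * rulW)) • v 0 := v_eq_smul 3
  have k2 : s 1 * r 0 = rulU * 1 * (s 0 * r 0) :=
    inj (by dsimp only; rw [← h2, e2, h0, smul_smul])
  have k3 : -(s 0 * r 1) = -(1 * rulW) * (s 0 * r 0) :=
    inj (by dsimp only; rw [← h3, e3, h0, smul_smul])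
  refine ⟨hs, hr, ?_, ?_⟩
  · rw [div_eq_iff hs]
    apply mul_right_cancel₀ hr
    linear_combination k2
  · rw [div_eq_iff hr]
    apply mul_left_cancel₀ hs
    linear_combination -k3

/-! ### The divisors of `U`, `W`, `1 ± s` and `ds` -/

section Main

variable {a b c d : Point}

/-- The four special points are distinct, and all other points have trivial orders. -/
theorem hasOrds_or_eq (ha : HasOrds a (-2) (-1) (-5) (-5)) (hb : HasOrds b 2 1 0 0)
    (hc : HasOrds c 1 (-2) 5 0) (hd : HasOrds d (-1) 2 0 5) (P : Point) :
    ∃ i j p m : ℤ, HasOrds P i j p m ∧ ∃ α β γ δ : ℤ,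
      pt a P = α ∧ pt b P = β ∧ pt c P = γ ∧ pt d P = δ ∧
      i = -2 * α + 2 * β + γ - δ ∧ j = -α + β - 2 * γ + 2 * δ ∧
      p = -5 * α + 5 * γ ∧ m = -5 * α + 5 * δ ∧
      0 ≤ α ∧ 0 ≤ β ∧ 0 ≤ γ ∧ 0 ≤ δ ∧ α + β + γ + δ ≤ 1 := by
  classical
  have key : ∀ {Q R : Point} {i j p m i' j' p' m' : ℤ}, HasOrds Q i j p m →
      HasOrds R i' j' p' m' → i ≠ i' → pt Q R = 0 := by
    intro Q R i j p m i' j' p' m' h h' hne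
    rw [pt, Finsupp.single_apply, if_neg]
    rintro rfl
    exact hne (h.U.symm.trans h'.U)
  rcases hasOrds_cases P with h | h | h | h | ⟨h, -⟩
  · obtain rfl := h.eqA ha
    exact ⟨_, _, _, _, h, 1, 0, 0, 0, by simp [pt], key hb h (by norm_num), key hc h (by norm_num),
      key hd h (by norm_num), by norm_num⟩
  · obtain rfl := h.eqB hb
    exact ⟨_, _, _, _, h, 0, 1, 0, 0, key ha h (by norm_num), by simp [pt], key hc h (by norm_num),
      key hd h (by norm_num), by norm_num⟩
  · obtain rfl := h.eqC hc
    exact ⟨_, _, _, _, h, 0, 0, 1, 0, key ha h (by norm_num), key hb h (by norm_num), by simp [pt],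
      key hd h (by norm_num), by norm_num⟩
  · obtain rfl := h.eqD hd
    exact ⟨_, _, _, _, h, 0, 0, 0, 1, key ha h (by norm_num), key hb h (by norm_num),
      key hc h (by norm_num), by simp [pt], by norm_num⟩
  · exact ⟨_, _, _, _, h, 0, 0, 0, 0, key ha h (by norm_num), key hb h (by norm_num),
      key hc h (by norm_num), key hd h (by norm_num), by norm_num⟩

/-- The orders of `uⁱ wʲ (1 + u² w)ᵏ (1 - u² w)ˡ`. -/
theorem HasOrds.ord_product {P : Point} {i j p m : ℤ} (h : HasOrds P i j p m) (k l r n : ℤ) :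
    P.ord (rulU ^ k * rulW ^ l * (1 + cyc) ^ r * (1 - cyc) ^ n) =
      k * i + l * j + r * p + n * m := by
  have h1 := zpow_ne_zero k rulU_ne_zero
  have h2 := zpow_ne_zero l rulW_ne_zero
  have h3 := zpow_ne_zero r one_add_cyc_ne_zero
  have h4 := zpow_ne_zero n one_sub_cyc_ne_zero
  rw [ord_mul (mul_ne_zero (mul_ne_zero h1 h2) h3) h4, ord_mul (mul_ne_zero h1 h2) h3,
    h.ord_monomial, ord_zpow, ord_zpow, h.plus, h.minus]

theorem product_ne_zero (k l r n : ℤ) :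
    rulU ^ k * rulW ^ l * (1 + cyc) ^ r * (1 - cyc) ^ n ≠ 0 :=
  mul_ne_zero (mul_ne_zero (mul_ne_zero (zpow_ne_zero k rulU_ne_zero) (zpow_ne_zero l rulW_ne_zero))
    (zpow_ne_zero r one_add_cyc_ne_zero)) (zpow_ne_zero n one_sub_cyc_ne_zero)

theorem isDivisorOfDifferential_D_cyc (ha : HasOrds a (-2) (-1) (-5) (-5))
    (hb : HasOrds b 2 1 0 0) (hc : HasOrds c 1 (-2) 5 0) (hd : HasOrds d (-1) 2 0 5)
    {P : Point} {g : FunctionField}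
    (h : (HasOrds P (-2) (-1) (-5) (-5) ∧ P.ord g = -6) ∨ (HasOrds P 2 1 0 0 ∧ P.ord g = 4) ∨
      (HasOrds P 1 (-2) 5 0 ∧ P.ord g = 4) ∨ (HasOrds P (-1) 2 0 5 ∧ P.ord g = 4) ∨
      (HasOrds P 0 0 0 0 ∧ P.ord g = 0)) :
    P.ord g = (4 • pt b + 4 • pt c + 4 • pt d - 6 • pt a : Divisor) P := by
  obtain ⟨i, j, p, m, h', α, β, γ, δ, e1, e2, e3, e4, e5, e6, e7, e8, e9⟩ :=
    hasOrds_or_eq ha hb hc hd P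
  have hU := h'.U
  have hW := h'.W
  simp only [Finsupp.sub_apply, Finsupp.add_apply, Finsupp.smul_apply, e1, e2, e3, e4,
    nsmul_eq_mul]
  push_cast
  rcases h with ⟨h, hg⟩ | ⟨h, hg⟩ | ⟨h, hg⟩ | ⟨h, hg⟩ | ⟨h, hg⟩ <;>
    · have hU' := h.U
      have hW' := h.W
      omega

end Main

end BringCurve

/-! ### The fibres and the linear equivalences -/

theorem mainTheorem9 :
    ∃ a b c d : BringCurve.Point,
      -- the four points `a`, `b`, `c`, `d` exist and are determined by their local expansions
      (∀ P, BringCurve.IsPointA P ↔ P = a) ∧ (∀ P, BringCurve.IsPointB P ↔ P = b) ∧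
      (∀ P, BringCurve.IsPointC P ↔ P = c) ∧ (∀ P, BringCurve.IsPointD P ↔ P = d) ∧
      ∃ L L' Δ : BringCurve.Divisor,
        L = 2 • BringCurve.pt d + BringCurve.pt b ∧
        L' = 2 • BringCurve.pt b + BringCurve.pt c ∧
        Δ = 3 • BringCurve.pt a + BringCurve.pt b - BringCurve.pt c ∧
        -- `L'` and `L` are the fibres over `[1 : 0]` of the two rulings `f₁` and `f₂`
        (∃ s r, BringCurve.AreRulings s r) ∧
        (∀ s r, BringCurve.AreRulings s r →
          BringCurve.IsFibreOneZero s L' ∧ BringCurve.IsFibreOneZero r L) ∧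
        -- the three linear equivalences
        BringCurve.LinEquiv Δ (3 • (L' - L) + L) ∧
        (∃ K, BringCurve.IsCanonical K) ∧
        (∀ K, BringCurve.IsCanonical K → BringCurve.LinEquiv K (L + L')) ∧
        BringCurve.LinEquiv (5 • (L' - L)) 0 := by
  open BringCurve in
  obtain ⟨a, ha⟩ := exists_pointA
  obtain ⟨b, hb⟩ := exists_pointB
  obtain ⟨c, hc⟩ := exists_pointC
  obtain ⟨d, hd⟩ := exists_pointD
  -- All orders at `P` are linear in the multiplicities `α, β, γ, δ` of `a, b, c, d`, so each
  -- divisor identity reduces to integer arithmetic. For the fibres, the bound `α + β + γ + δ ≤ 1`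
  -- resolves the maximum with zero.
  have cases := hasOrds_or_eq ha hb hc hd
  refine ⟨a, b, c, d, fun P => ⟨fun h => h.hasOrds.eqA ha, fun h => h ▸ ha.isPointA⟩,
    fun P => ⟨fun h => h.hasOrds.eqB hb, fun h => h ▸ hb.isPointB⟩,
    fun P => ⟨fun h => h.hasOrds.eqC hc, fun h => h ▸ hc.isPointC⟩,
    fun P => ⟨fun h => h.hasOrds.eqD hd, fun h => h ▸ hd.isPointD⟩,
    _, _, _, rfl, rfl, rfl, ⟨_, _, areRulings_rul⟩, fun s r h => ?_, ?_, ?_, fun K hK => ?_, ?_⟩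
  · obtain ⟨hs, hr, h1, h2⟩ := h.eq
    refine ⟨⟨hs, ?_, fun P => ?_⟩, ⟨hr, ?_, fun P => ?_⟩⟩
    · intro hz; rw [hz, zero_div] at h1; exact rulU_ne_zero h1.symm
    · obtain ⟨i, j, p, m, h', α, β, γ, δ, e1, e2, e3, e4, e⟩ := cases P
      rw [h1, h'.U]
      simp only [Finsupp.add_apply, Finsupp.smul_apply, e2, e3, nsmul_eq_mul]
      push_cast
      omega
    · intro hz; rw [hz, zero_div] at h2; exact rulW_ne_zero h2.symm
    · obtain ⟨i, j, p, m, h', α, β, γ, δ, e1, e2, e3, e4, e⟩ := cases P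
      rw [h2, h'.W]
      simp only [Finsupp.add_apply, Finsupp.smul_apply, e2, e4, nsmul_eq_mul]
      push_cast
      omega
  -- The witness is `U⁻² W`, with divisor `3a - 3b - 4c + 4d`.
  · refine ⟨_, product_ne_zero (-2) 1 0 0, fun P => ?_⟩
    obtain ⟨i, j, p, m, h', α, β, γ, δ, e1, e2, e3, e4, e⟩ := cases P
    rw [h'.ord_product]
    simp only [Finsupp.add_apply, Finsupp.sub_apply, Finsupp.smul_apply, e1, e2, e3, e4,
      nsmul_eq_mul]
    push_cast
    omega
  · refine ⟨4 • pt b + 4 • pt c + 4 • pt d - 6 • pt a,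
      KaehlerDifferential.D ℂ FunctionField cyc, D_cyc_ne_zero, fun P => ?_⟩
    obtain ⟨t, g, hl, hg, g0, h⟩ := exists_D_cyc P
    exact ⟨t, g, hl.ord_eq, g0, hg, isDivisorOfDifferential_D_cyc ha hb hc hd h⟩
  · obtain ⟨ω, hω, hdiv⟩ := hK
    obtain ⟨h, rfl⟩ := exists_eq_smul_D_cyc ω
    have h0 : h ≠ 0 := by rintro rfl; simp at hω
    -- The differential `ds / (W (1 + s))` has divisor exactly `L + L'`, so for `ω = h ds` the
    -- witness is `h W (1 + s)`.
    refine ⟨_, mul_ne_zero h0 (product_ne_zero 0 1 1 0), fun P => ?_⟩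
    obtain ⟨t, g, hl, hg, g0, hcase⟩ := exists_D_cyc P
    obtain ⟨t', g', ht', g0', hh, hK⟩ := hdiv P
    have o1 := Point.ord_mul (P := P) h0 (product_ne_zero 0 1 1 0)
    have o2 := ord_differential_eq hl hg g0 ht' g0' h0 hh
    have o3 := isDivisorOfDifferential_D_cyc ha hb hc hd hcase
    obtain ⟨i, j, p, m, h', α, β, γ, δ, e1, e2, e3, e4, e⟩ := cases P
    rw [o1, h'.ord_product]
    simp only [Finsupp.add_apply, Finsupp.sub_apply, Finsupp.smul_apply, e1, e2, e3, e4,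
      nsmul_eq_mul, ← hK] at o3 ⊢
    push_cast at o3 ⊢
    omega
  -- The witness is `s (1 + s) / (1 - s)²`, with divisor `5b + 5c - 10d`: it is pulled back from the
  -- line, and total ramification supplies the factor five.
  · refine ⟨_, product_ne_zero 2 1 1 (-2), fun P => ?_⟩
    obtain ⟨i, j, p, m, h', α, β, γ, δ, -, e2, e3, e4, e⟩ := cases P
    rw [h'.ord_product]
    simp only [Finsupp.add_apply, Finsupp.sub_apply, Finsupp.smul_apply, e2, e3, e4,
      nsmul_eq_mul, Finsupp.coe_zero, Pi.zero_apply]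
    push_cast
    omega
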